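/- **Model.** Let $\lambda,\mu,\xi>0$, $0<a\le 1$, $b=1-a$. On a probability space, attack times $t_1<t_2<\cdots$ form a Poisson point process of rate $\lambda$ on $[0,\infty)$; the $k$-th attack destroys $n_k$ nodes, where the $n_k$ are iid with $P\{n_k=m\}=ab^{m-1}$, $m\ge 1$; the $j$-th node destroyed by it has weight $w_{jk}$, where the $w_{jk}$ are iid exponential with parameter $\xi$. The losses are observed at epochs $0=\tau_0<\tau_1<\tau_2<\cdots$ whose increments $\tau_i-\tau_{i-1}$ are iid exponential with parameter $\mu$. The families $(t_k)$, $(n_k)$, $(w_{jk})$, $(\tau_i)$ are mutually independent. Let $$N_i=\sum_{k:\,t_k\le\tau_i}n_k,\qquad W_i=\sum_{k:\,t_k\le\tau_i}\ \sum_{j=1}^{n_k}w_{jk}$$ be the numbers of nodes and the weight lost up to the observation $\tau_i$. For integers $0\le M_1<M$ and a real $V>0$ define the exit indices (denoted $\mu_1,\boldsymbol\mu,\nu$; the index $\boldsymbol\mu$ is not to be confused with the rate $\mu$) $$\mu_1=\inf\{i\ge0:N_i>M_1\},\qquad \boldsymbol\mu=\inf\{i\ge0:N_i>M\},\qquad \nu=\inf\{i\ge0:W_i>V\}.$$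 **Notation.** Let $P(x,y)=1-\Gamma(x,y)/\Gamma(x)$ for $x,y>0$, where $\Gamma(x,y)=\int_y^\infty s^{x-1}e^{-s}\,ds$, and $P(0,y)=1$. Empty sums are $0$. Put $$c(\theta)=\frac{\lambda+b\theta}{\lambda+\theta},\qquad d(\theta)=\frac{\lambda+b(\mu+\theta)}{\lambda+\mu+\theta},\qquad s(h,0)=\sum_{i=1}^{M-M_1-1}\Bigl(\frac{c(h)}{d(0)}\Bigr)^i,$$ $$r_0^{m-1}=r_0^{m-1}(1,0,0)=e^{-\xi V}\sum_{i=0}^{m-1}\frac{(\xi\,d(0)V)^i}{i!}\qquad(m\ge 0).$$ **Proposition 5.11.** For every complex $h$ with $\operatorname{Re}h\ge 0$, the random variable $e^{-h(\tau_{\min(\boldsymbol\mu,\nu)}-\tau_{\mu_1})}\mathbf 1_{\{\mu_1<\min(\boldsymbol\mu,\nu)\}}$ is integrable and $$\begin{aligned} &E\Bigl[e^{-h(\tau_{\min(\boldsymbol\mu,\nu)}-\tau_{\mu_1})}\mathbf 1_{\{\mu_1<\min(\boldsymbol\mu,\nu)\}}\Bigr]\\ &=\frac{a\mu^2\lambda}{(\mu+\lambda)(\mu+h)(h+\lambda)(1-d(0))}\Biggl\{\Bigl[P(M_1,\xi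 V)-\frac{e^{-\xi(1-d(0))V}-r_0^{M_1-1}}{d(0)^{M_1}}\Bigr]\\ &\quad+\frac{c(h)-1}{c(h)}\sum_{j=1}^{M-M_1-1}c(h)^j\Bigl[P(M_1+j,\xi V)-\frac{e^{-\xi(1-d(0))V}-r_0^{M_1+j-1}}{d(0)^{M_1+j}}\Bigr]\\ &\quad-d(0)^{M-M_1}\Bigl(1+\frac{c(h)-1}{c(h)}\,s(h,0)\Bigr)\Bigl[P(M,\xi V)-\frac{e^{-\xi(1-d(0))V}-r_0^{M-1}}{d(0)^{M}}\Bigr]\Biggr\}. \end{aligned}$$ -/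

import Mathlib

open MeasureTheory ProbabilityTheory

noncomputable section

namespace NetworkDefense

/-! Random data of the model, on a probability space `Ω` (all sequences start at index `0`):
`t k` is the time of the `(k+1)`-st attack, `n k` the number of nodes it destroys, `w k j` the weight
of the `(j+1)`-st node destroyed by it, and `τ i` the `i`-th observation epoch. -/

variable {Ω : Type*}

/-- The support counting measure `∑ₖ ε_{t_k}` of the attacks. -/
def attackMeasure (t : ℕ → Ω → ℝ) (ω : Ω) : Measure ℝ :=
  Measure.sum fun k => Measure.dirac (t k ω)

/-- The random measure `𝒩 = ∑ₖ n_k ε_{t_k}` counting the destroyed nodes. -/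
def nodeMeasure (t : ℕ → Ω → ℝ) (n : ℕ → Ω → ℕ) (ω : Ω) : Measure ℝ :=
  Measure.sum fun k => (n k ω : ENNReal) • Measure.dirac (t k ω)

/-- The random measure `𝒲 = ∑ₖ w_k ε_{t_k}`, where `w_k` is the sum of the weights of the `n_k`
nodes destroyed by the attack at time `t_k`. -/
def weightMeasure (t : ℕ → Ω → ℝ) (n : ℕ → Ω → ℕ) (w : ℕ → ℕ → Ω → ℝ) (ω : Ω) : Measure ℝ :=
  Measure.sum fun k =>
    ENNReal.ofReal (∑ j ∈ Finset.range (n k ω), w k j ω) • Measure.dirac (t k ω)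

/-- `(t_k)` enumerates, in increasing order, a Poisson point process on `[0, ∞)` of rate `lam`:
the numbers of points in disjoint Borel sets of finite Lebesgue measure are independent Poisson
variables whose parameters are `lam` times the Lebesgue measures of the sets. -/
structure IsPoissonPointProcess [MeasurableSpace Ω] (P : Measure Ω) (lam : ℝ)
    (t : ℕ → Ω → ℝ) : Prop where
  measurable : ∀ k, Measurable (t k)
  nonneg : ∀ᵐ ω ∂P, ∀ k, 0 ≤ t k ω
  strictMono : ∀ᵐ ω ∂P, StrictMono fun k => t k ω
  law : ∀ (m : ℕ) (B : Fin m → Set ℝ), (∀ i, MeasurableSet (B i)) → (∀ i, B i ⊆ Set.Ici 0) →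
    (∀ i, volume (B i) < ⊤) → (Pairwise fun i j => Disjoint (B i) (B j)) →
    ∀ r : Fin m → ℕ,
      P {ω | ∀ i, attackMeasure t ω (B i) = (r i : ENNReal)} =
        ∏ i, poissonMeasure (lam.toNNReal * (volume (B i)).toNNReal) {r i}

/-- The model with exponential observations: Poisson attacks of rate `lam`, geometric batches
on `{1, 2, …}` with parameter `a`, exponential node weights with parameter `xi`, and an independent
renewal process of observations with exponential inter-observation times with parameter `mu` and
first observation at time `0` (so that there is no initial damage). -/
structure ExponentialObservationModel [MeasurableSpace Ω] (P : Measure Ω) (lam mu a xi : ℝ)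
    (t : ℕ → Ω → ℝ) (n : ℕ → Ω → ℕ) (w : ℕ → ℕ → Ω → ℝ) (τ : ℕ → Ω → ℝ) : Prop where
  attacks : IsPoissonPointProcess P lam t
  measurable_nodes : ∀ k, Measurable (n k)
  measurable_weight : ∀ k j, Measurable (w k j)
  measurable_observation : ∀ i, Measurable (τ i)
  nodes_law : ∀ k m, P {ω | n k ω = m + 1} = ENNReal.ofReal (a * (1 - a) ^ m)
  nodes_indep : iIndepFun n P
  weight_law : ∀ k j, P.map (w k j) = expMeasure xi
  weight_indep : iIndepFun (fun p : ℕ × ℕ => w p.1 p.2) P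
  initial_observation : ∀ᵐ ω ∂P, τ 0 ω = 0
  increment_law : ∀ i, P.map (fun ω => τ (i + 1) ω - τ i ω) = expMeasure mu
  increment_indep : iIndepFun (fun i ω => τ (i + 1) ω - τ i ω) P
  /- The last three fields together say that the attack times, the batch sizes, the node weights and
  the observation epochs are four mutually independent families. -/
  indep_nodes : IndepFun (fun ω k => t k ω) (fun ω k => n k ω) P
  indep_weight : IndepFun (fun ω => ((fun k => t k ω), (fun k => n k ω)))
    (fun ω k j => w k j ω) P
  indep_observation : IndepFun
    (fun ω => ((fun k => t k ω), (fun k => n k ω), (fun k j => w k j ω)))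
    (fun ω i => τ i ω) P

/-- The window of time covered by the `i`-th observation: `[0, τ₀]` for `i = 0` and
`(τ_{i-1}, τ_i]` for `i ≥ 1`. -/
def window (τ : ℕ → Ω → ℝ) (ω : Ω) : ℕ → Set ℝ
  | 0 => Set.Icc 0 (τ 0 ω)
  | i + 1 => Set.Ioc (τ i ω) (τ (i + 1) ω)

/-- `N_m = X_0 + ⋯ + X_m`, where `X_i` is the number of nodes lost in the `i`-th window. -/
def observedNodes (t : ℕ → Ω → ℝ) (n : ℕ → Ω → ℕ) (τ : ℕ → Ω → ℝ) (m : ℕ) (ω : Ω) : ENNReal :=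
  ∑ i ∈ Finset.range (m + 1), nodeMeasure t n ω (window τ ω i)

/-- `W_m = Y_0 + ⋯ + Y_m`, where `Y_i` is the weight lost in the `i`-th window. -/
def observedWeight (t : ℕ → Ω → ℝ) (n : ℕ → Ω → ℕ) (w : ℕ → ℕ → Ω → ℝ) (τ : ℕ → Ω → ℝ)
    (m : ℕ) (ω : Ω) : ENNReal :=
  ∑ i ∈ Finset.range (m + 1), weightMeasure t n w ω (window τ ω i)

/-- The exit index `inf {m ≥ 0 : S_m > level}`, which is `⊤` if there is no such `m`. -/
def exitIndex (S : ℕ → Ω → ENNReal) (level : ENNReal) (ω : Ω) : ℕ∞ :=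
  sInf ((fun m : ℕ => (m : ℕ∞)) '' {m | level < S m ω})

/-- `P(x, y) = 1 - Γ(x, y) / Γ(x)` with `Γ(x, y) = ∫_y^∞ s^{x-1} e^{-s} ds`. For `y > 0` this gives
`P(0, y) = 1`, the limit of `P(x, y)` as `x ↓ 0`, because `Real.Gamma 0 = 0`. -/
def regGamma (x y : ℝ) : ℝ :=
  1 - (∫ s in Set.Ioi y, s ^ (x - 1) * Real.exp (-s)) / Real.Gamma x

/-- `c(θ) = (λ + bθ) / (λ + θ)` with `b = 1 - a`. -/
def cFun (lam a : ℝ) (θ : ℂ) : ℂ := (lam + (1 - a) * θ) / (lam + θ)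

/-- `d(θ) = (λ + b(μ + θ)) / (λ + μ + θ)` with `b = 1 - a`. -/
def dFun (lam mu a : ℝ) (θ : ℂ) : ℂ := (lam + (1 - a) * (mu + θ)) / (lam + mu + θ)

/-- `r_0^{m-1}(u, v, θ) = e^{-(v+ξ)V} ∑_{i=0}^{m-1} (ξ d(θ) u V)^i / i!`; the number `m` of terms is
the argument, so that the sum is empty for `m = 0`. -/
def rFun (lam mu a xi V : ℝ) (m : ℕ) (u v θ : ℂ) : ℂ :=
  Complex.exp (-(v + xi) * V) *
    ∑ i ∈ Finset.range m, (xi * dFun lam mu a θ * u * V) ^ i / (i.factorial : ℂ)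

/-- `s(x, y) = ∑_{i=1}^{M-M₁-1} (c(x) / d(y))^i`, used for `M₁ < M`. -/
def sFun (lam mu a : ℝ) (M₁ M : ℕ) (x y : ℂ) : ℂ :=
  ∑ i ∈ Finset.Icc 1 (M - M₁ - 1), (cFun lam a x / dFun lam mu a y) ^ i

end NetworkDefense

end

/-!
Let `Δ_i = τ_{i+1} - τ_i`, let `X_i` be the number of nodes lost in the window `(τ_i, τ_{i+1}]`, and
let `N_l = X_0 + ⋯ + X_{l-1}`. The formula is a renewal computation for the walk `N`, which rests on
three successive conditionings (`setIntegral_of_indepFun`).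

Given the epochs, the attack counts of the windows are independent Poisson variables; given also the
attack times, the node counts are independent sums of geometric batches. Hence the pairs `(Δ_i, X_i)`
are independent (`iIndepFun_gap_nodeCount`), and the transform `E[exp (-h Δ_i); X_i = x]`, called
`windowCoeff`, has the rational generating function
`(μ / (μ + λ + h)) (1 - b X) / (1 - d(h) X)` (`windowSeries_rational`). Given everything but the
weights, the weight of `m` lost nodes is at most `V` with the Erlang probability
`P(m, ξV)` (`setIntegral_observedWeight`, `regGamma_natCast`).

Write `ρ` for the minimum of the exit indices of the levels `M` and `V`. The random variable in
question is almost surely a sum over `l` of its restrictions to `ρ = l + 1`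
(`IsRegularPath.hasSum_exitTerm`), and `ρ = l + 1` is the difference of the events `ρ > l` and
`ρ > l + 1`, on which `(N_l, W_l)`, respectively `(N_{l+1}, W_{l+1})`, is within the levels. Let
`y(m)` be the sum over `l` of the expected discounts on `N_l = m`, where a window is discounted at
rate `h` if it begins with more than `M₁` lost nodes. Termwise integration gives
`∑_{M₁ < m ≤ M} P(m, ξV) (μ / (μ + h) y(m) - ∑_{M₁ < p ≤ m} y(p) E[exp (-h Δ); X = m - p])`.
Now `y` satisfies a renewal equation (`tsum_expectedDiscount_eq`), whose solution shows that the
factor of `P(m, ξV)` is a constant times the coefficient of `X^{m - M₁ - 1}` in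
`(1 - X) / ((1 - d(0) X) (1 - c(h) X))` (`sum_renewal_eq`).

The bracket `Q(m)` of the formula satisfies `Q(m) - d(0) Q(m + 1) = (1 - d(0)) P(m + 1, ξV)`
(`erlangCdf_sub_div_pow`), and Abel summation (`sum_icc_telescope`) gives the stated expression.
-/

noncomputable section

namespace NetworkDefense

variable {Ω : Type*}

/-! ### Conditioning and independence -/

/-- Conditioning on `W`: if `U` and `W` are independent, integrating `g (W)` over the event
`(U, W) ∈ C` amounts to weighting `g` with the probability `q` of the section of `C` at `W`. -/
theorem setIntegral_of_indepFun [MeasurableSpace Ω] {P : Measure Ω} [IsProbabilityMeasure P]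
    {α β : Type*} [MeasurableSpace α] [MeasurableSpace β] {U : Ω → α} {W : Ω → β}
    (hU : Measurable U) (hW : Measurable W) (hUW : IndepFun U W P)
    {C : Set (α × β)} (hC : MeasurableSet C) {g : β → ℂ} (hg : Measurable g)
    (hgi : Integrable (fun ω => g (W ω)) P) {q : β → ℝ}
    (hq : ∀ᵐ ω ∂P, P.real {ω' | (U ω', W ω) ∈ C} = q (W ω)) :
    ∫ ω in {ω | (U ω, W ω) ∈ C}, g (W ω) ∂P = ∫ ω, g (W ω) * (q (W ω) : ℂ) ∂P := by
  have hprod : P.map (fun ω => (U ω, W ω)) = (P.map U).prod (P.map W) :=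
    (indepFun_iff_map_prod_eq_prod_map_map hU.aemeasurable hW.aemeasurable).1 hUW
  have : IsProbabilityMeasure (P.map U) := Measure.isProbabilityMeasure_map hU.aemeasurable
  have : IsProbabilityMeasure (P.map W) := Measure.isProbabilityMeasure_map hW.aemeasurable
  have hgm : Measurable (fun p : α × β => g p.2) := hg.comp measurable_snd
  have hgi' : Integrable (fun p : α × β => g p.2) ((P.map U).prod (P.map W)) := by
    rw [← hprod, integrable_map_measure hgm.aestronglyMeasurable (hU.prodMk hW).aemeasurable]
    exact hgi
  calc ∫ ω in {ω | (U ω, W ω) ∈ C}, g (W ω) ∂P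
      = ∫ p in C, g p.2 ∂(P.map (fun ω => (U ω, W ω))) := by
        rw [setIntegral_map hC hgm.aestronglyMeasurable (hU.prodMk hW).aemeasurable]
        rfl
    _ = ∫ p, C.indicator (fun p => g p.2) p ∂((P.map U).prod (P.map W)) := by
        rw [hprod, integral_indicator hC]
    _ = ∫ v, ∫ u, C.indicator (fun p => g p.2) (u, v) ∂(P.map U) ∂(P.map W) :=
        integral_prod_symm _ (hgi'.indicator hC)
    _ = ∫ v, g v * ((P.map U).real {u | (u, v) ∈ C} : ℂ) ∂(P.map W) := by
        refine integral_congr_ae (Filter.Eventually.of_forall fun v => ?_)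
        have hCv : MeasurableSet {u | (u, v) ∈ C} := measurable_prodMk_right hC
        have : ∀ u, C.indicator (fun p : α × β => g p.2) (u, v)
            = {u | (u, v) ∈ C}.indicator (fun _ => g v) u := by
          intro u; by_cases hu : (u, v) ∈ C <;> simp [hu]
        simp only [this]
        rw [integral_indicator hCv, setIntegral_const, mul_comm]
        simp
    _ = ∫ ω, g (W ω) * ((P.map U).real {u | (u, W ω) ∈ C} : ℂ) ∂P := by
        rw [integral_map hW.aemeasurable]
        refine (hg.mul ?_).aestronglyMeasurable
        exact Complex.measurable_ofReal.comp (measurable_measure_prodMk_right hC).ennreal_toReal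
    _ = _ := by
        refine integral_congr_ae ?_
        filter_upwards [hq] with ω hω
        have hCω : MeasurableSet {u | (u, W ω) ∈ C} := measurable_prodMk_right hC
        rw [← hω, map_measureReal_apply hU hCω]
        rfl

/-- A family of pairs (real, natural) is independent as soon as the events `{X ∈ B, K = k}`, with
the second coordinate prescribed, are. -/
theorem iIndepFun_pair_of_measure_inter [MeasurableSpace Ω] {P : Measure Ω}
    {ι : Type*} {X : ι → Ω → ℝ} {K : ι → Ω → ℕ} (hX : ∀ i, Measurable (X i))
    (hK : ∀ i, Measurable (K i))
    (hind : ∀ (s : Finset ι) (B : ι → Set ℝ) (k : ι → ℕ), (∀ i, MeasurableSet (B i)) →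
      P {ω | ∀ i ∈ s, X i ω ∈ B i ∧ K i ω = k i} = ∏ i ∈ s, P {ω | X i ω ∈ B i ∧ K i ω = k i}) :
    iIndepFun (fun i ω => (X i ω, K i ω)) P := by
  -- Prescribing the second coordinate gives a `π`-system, since `{k}` and `{k'}` meet only if equal.
  let π : ι → Set (Set Ω) := fun i =>
    {A | ∃ (B : Set ℝ) (k : ℕ), MeasurableSet B ∧ A = {ω | X i ω ∈ B ∧ K i ω = k}}
  rw [iIndepFun_iff_iIndep]
  refine iIndepSets.iIndep (fun i => ((hX i).prodMk (hK i)).comap_le) π ?_ ?_ ?_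
  · rintro i _ ⟨B, k, hB, rfl⟩ _ ⟨B', k', hB', rfl⟩ ⟨ω, ⟨-, h1⟩, ⟨-, h2⟩⟩
    obtain rfl : k = k' := h1.symm.trans h2
    exact ⟨B ∩ B', k, hB.inter hB', by ext ω; simp; tauto⟩
  · intro i
    apply le_antisymm
    · rintro _ ⟨S, hS, rfl⟩
      have : (fun ω => (X i ω, K i ω)) ⁻¹' S
          = ⋃ k : ℕ, {ω | X i ω ∈ {x | (x, k) ∈ S} ∧ K i ω = k} := by
        ext ω; simp
      rw [this]
      exact MeasurableSet.iUnion fun k => MeasurableSpace.measurableSet_generateFrom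
        ⟨_, k, measurable_prodMk_right hS, rfl⟩
    · refine MeasurableSpace.generateFrom_le ?_
      rintro _ ⟨B, k, hB, rfl⟩
      exact ⟨B ×ˢ {k}, hB.prod (measurableSet_singleton k), by ext; simp⟩
  · rw [iIndepSets_iff]
    intro s f hf
    choose! B k hB hfe using hf
    classical
    have := hind s (fun i => if i ∈ s then B i else Set.univ) k (fun i => by
      by_cases hi : i ∈ s <;> simp [hi, hB])
    rw [Finset.prod_congr rfl (fun i hi => by rw [hfe i hi])]
    convert this using 1
    · congr 1
      ext ω
      simp only [Set.mem_iInter, Set.mem_ofPred_eq]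
      refine forall₂_congr fun i hi => ?_
      rw [hfe i hi]; simp [hi]
    · exact Finset.prod_congr rfl fun i hi => by simp [hi]

/-- In an independent sequence, a functional of the terms before `l` is independent of the
`l`-th term. -/
theorem indepFun_of_dependsOn_lt [MeasurableSpace Ω] {P : Measure Ω}
    {β γ : Type*} [MeasurableSpace β] [MeasurableSpace γ] [Inhabited β] {Z : ℕ → Ω → β}
    (hZ : ∀ i, Measurable (Z i)) (hind : iIndepFun Z P) {l : ℕ} {F : (ℕ → β) → γ}
    (hF : Measurable F) (hdep : ∀ ζ ζ' : ℕ → β, (∀ i < l, ζ i = ζ' i) → F ζ = F ζ') :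
    IndepFun (fun ω => F (fun i => Z i ω)) (Z l) P := by
  -- `e` fills up a finite stretch of the sequence by a default value, which `F` does not see.
  let e : (↥(Finset.range l) → β) → (ℕ → β) := fun z i =>
    if hi : i ∈ Finset.range l then z ⟨i, hi⟩ else default
  have he : Measurable e := by
    refine measurable_pi_lambda _ fun i => ?_
    by_cases hi : i ∈ Finset.range l
    · simp only [e, hi, dite_true]; exact measurable_pi_apply _
    · simp only [e, hi, dite_false]; exact measurable_const
  have h1 := hind.indepFun_finset (Finset.range l) {l} (by simp) hZ
  have hev : Measurable fun z : ↥({l} : Finset ℕ) → β => z ⟨l, by simp⟩ := by fun_prop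
  have h2 := h1.comp (hF.comp he) hev
  have h3 : (fun ω => F (fun i => Z i ω))
      = (F ∘ e) ∘ fun ω (i : ↥(Finset.range l)) => Z i ω := by
    ext ω
    refine hdep _ _ fun i hi => ?_
    simp [e, hi]
  rw [h3]
  exact h2

/-! ### Exponential and Erlang laws -/

theorem hasDerivAt_exp_neg_mul_sum (m : ℕ) (s : ℝ) :
    HasDerivAt (fun s : ℝ => Real.exp (-s) * ∑ i ∈ Finset.range (m + 1), s ^ i / (i.factorial : ℝ))
      (-(s ^ m / (m.factorial : ℝ) * Real.exp (-s))) s := by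
  have he : HasDerivAt (fun s : ℝ => Real.exp (-s)) (-Real.exp (-s)) s := by
    simpa using (hasDerivAt_neg s).exp
  induction m with
  | zero => simpa using he
  | succ m ih =>
    have h1 : HasDerivAt (fun s : ℝ => Real.exp (-s) * (s ^ (m + 1) / ((m + 1).factorial : ℝ)))
        (-Real.exp (-s) * (s ^ (m + 1) / ((m + 1).factorial : ℝ))
          + Real.exp (-s) * ((m + 1 : ℕ) * s ^ m / ((m + 1).factorial : ℝ))) s := by
      simpa using he.fun_mul ((hasDerivAt_pow (m + 1) s).div_const _)
    convert! ih.add h1 using 1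
    · ext s; simp [Finset.sum_range_succ _ (m + 1)]; ring
    · rw [Nat.factorial_succ]; push_cast
      have : (m.factorial : ℝ) ≠ 0 := by positivity
      field_simp; ring

theorem hasDerivAt_cexp_neg_mul_sum (m : ℕ) (s : ℂ) :
    HasDerivAt
      (fun s : ℂ => Complex.exp (-s) * ∑ i ∈ Finset.range (m + 1), s ^ i / (i.factorial : ℂ))
      (-(s ^ m / (m.factorial : ℂ) * Complex.exp (-s))) s := by
  have he : HasDerivAt (fun s : ℂ => Complex.exp (-s)) (-Complex.exp (-s)) s := by
    simpa using (hasDerivAt_neg s).cexp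
  induction m with
  | zero => simpa using he
  | succ m ih =>
    have h1 : HasDerivAt (fun s : ℂ => Complex.exp (-s) * (s ^ (m + 1) / ((m + 1).factorial : ℂ)))
        (-Complex.exp (-s) * (s ^ (m + 1) / ((m + 1).factorial : ℂ))
          + Complex.exp (-s) * ((m + 1 : ℕ) * s ^ m / ((m + 1).factorial : ℂ))) s := by
      simpa using he.fun_mul ((hasDerivAt_pow (m + 1) s).div_const _)
    convert! ih.add h1 using 1
    · ext s; simp [Finset.sum_range_succ _ (m + 1)]; ring
    · rw [Nat.factorial_succ]; push_cast
      have : (m.factorial : ℂ) ≠ 0 := by exact_mod_cast m.factorial_ne_zero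
      have : (m + 1 : ℂ) ≠ 0 := by exact_mod_cast m.succ_ne_zero
      field_simp; ring

/-- The distribution function at `x ≥ 0` of the sum of `m` independent exponential variables with
parameter `1`; equivalently the probability that a Poisson variable with parameter `x` is at
least `m`. It is `1` for `m = 0`. -/
def erlangCdf (m : ℕ) (x : ℝ) : ℝ :=
  1 - Real.exp (-x) * ∑ i ∈ Finset.range m, x ^ i / (i.factorial : ℝ)

theorem tendsto_exp_neg_mul_sum (m : ℕ) :
    Filter.Tendsto
      (fun s : ℝ => Real.exp (-s) * ∑ i ∈ Finset.range m, s ^ i / (i.factorial : ℝ))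
      Filter.atTop (nhds 0) := by
  have : ∀ i ∈ Finset.range m, Filter.Tendsto
      (fun s : ℝ => s ^ i * Real.exp (-s) / (i.factorial : ℝ)) Filter.atTop (nhds 0) := by
    intro i _
    simpa using (Real.tendsto_pow_mul_exp_neg_atTop_nhds_zero i).div_const (i.factorial : ℝ)
  have h := tendsto_finsetSum _ this
  simp only [Finset.sum_const_zero] at h
  refine h.congr fun s => ?_
  rw [Finset.mul_sum]
  exact Finset.sum_congr rfl fun i _ => by ring

/-- At a natural number `m`, the regularized gamma function `P(m, y)` is the Erlang distribution
function. The case `m = 0` rests on `Real.Gamma 0 = 0`, which makes both sides equal to `1`. -/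
theorem regGamma_natCast (m : ℕ) {y : ℝ} (hy : 0 < y) : regGamma m y = erlangCdf m y := by
  rcases m with _ | m
  · simp [regGamma, erlangCdf]
  · have hd : ∀ s ∈ Set.Ici y, HasDerivAt
        (fun s : ℝ => -(Real.exp (-s) * ∑ i ∈ Finset.range (m + 1), s ^ i / (i.factorial : ℝ)))
        (s ^ m / (m.factorial : ℝ) * Real.exp (-s)) s := fun s _ => by
      simpa using (hasDerivAt_exp_neg_mul_sum m s).fun_neg
    have hint := integral_Ioi_of_hasDerivAt_of_nonneg' hd (fun s hs => by
      have : 0 < s := hy.trans hs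
      positivity) (by simpa using (tendsto_exp_neg_mul_sum (m + 1)).neg)
    have hI : ∫ s in Set.Ioi y, s ^ (((m + 1 : ℕ) : ℝ) - 1) * Real.exp (-s)
        = (m.factorial : ℝ) * ∫ s in Set.Ioi y, s ^ m / (m.factorial : ℝ) * Real.exp (-s) := by
      rw [← integral_const_mul]
      refine integral_congr_ae (Filter.Eventually.of_forall fun s => ?_)
      have : (m.factorial : ℝ) ≠ 0 := by positivity
      simp only [Nat.cast_add, Nat.cast_one, add_sub_cancel_right, Real.rpow_natCast]
      field_simp
    have hne : (m.factorial : ℝ) ≠ 0 := by positivity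
    rw [regGamma, hI, hint, erlangCdf]
    push_cast
    rw [Real.Gamma_nat_eq_factorial]
    field_simp
    ring

theorem integral_expMeasure {E : Type*} [NormedAddCommGroup E] [NormedSpace ℝ E] {r : ℝ}
    (hr : 0 < r) (g : ℝ → E) :
    ∫ u, g u ∂(expMeasure r) = ∫ u in Set.Ioi 0, (r * Real.exp (-(r * u))) • g u := by
  have h0 : ∀ u, (gammaPDF 1 r u).toReal • g u
      = (Set.Ici (0:ℝ)).indicator (fun u => (r * Real.exp (-(r * u))) • g u) u := by
    intro u
    by_cases hu : 0 ≤ u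
    · have : 0 ≤ r * Real.exp (-(r * u)) := by positivity
      simp [gammaPDF_eq, hu, ENNReal.toReal_ofReal this]
    · simp [gammaPDF_eq, hu]
  rw [expMeasure, gammaMeasure, integral_withDensity_eq_integral_toReal_smul]
  · simp only [h0]
    rw [integral_indicator measurableSet_Ici, integral_Ici_eq_integral_Ioi]
  · exact (measurable_gammaPDFReal 1 r).ennreal_ofReal
  · exact Filter.Eventually.of_forall fun u => ENNReal.ofReal_lt_top

theorem expMeasure_Iic_zero (r : ℝ) : expMeasure r (Set.Iic 0) = 0 := by
  rw [expMeasure, gammaMeasure, withDensity_apply _ measurableSet_Iic,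
    setLIntegral_congr Iio_ae_eq_Iic.symm]
  exact lintegral_gammaPDF_of_nonpos le_rfl

theorem ae_pos_of_map_eq_expMeasure [MeasurableSpace Ω] {P : Measure Ω} {X : Ω → ℝ} {r : ℝ}
    (hX : Measurable X) (hlaw : P.map X = expMeasure r) : ∀ᵐ ω ∂P, 0 < X ω := by
  have : ∀ᵐ x ∂(P.map X), 0 < x := by
    rw [hlaw, ae_iff]
    simpa [Set.Iic] using expMeasure_Iic_zero r
  exact ae_of_ae_map hX.aemeasurable this

theorem integrableOn_pow_mul_cexp (k : ℕ) {D : ℂ} (hD : 0 < D.re) :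
    IntegrableOn (fun u : ℝ => (u : ℂ) ^ k * Complex.exp (-(D * u))) (Set.Ioi 0) := by
  have h := integrableOn_rpow_mul_exp_neg_mul_rpow (p := 1) (s := k) (b := D.re)
    (by have : (0:ℝ) ≤ k := by positivity
        linarith) one_pos hD
  refine Integrable.mono' h ?_ ?_
  · have hc : Continuous fun u : ℝ => (u : ℂ) ^ k * Complex.exp (-(D * u)) := by fun_prop
    exact hc.aestronglyMeasurable
  · refine (ae_restrict_iff' measurableSet_Ioi).2 (Filter.Eventually.of_forall fun u hu => ?_)
    have hu : 0 < u := hu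
    simp [Complex.norm_exp, abs_of_pos hu]

theorem integral_pow_mul_cexp (k : ℕ) {D : ℂ} (hD : 0 < D.re) :
    ∫ u : ℝ in Set.Ioi 0, (u : ℂ) ^ k * Complex.exp (-(D * u)) = k.factorial / D ^ (k + 1) := by
  have hD0 : D ≠ 0 := by rintro rfl; simp at hD
  have hk : (k.factorial : ℂ) ≠ 0 := by exact_mod_cast k.factorial_ne_zero
  let F : ℝ → ℂ := fun u => -(k.factorial / D ^ (k + 1)) * (Complex.exp (-(D * u)) *
    ∑ i ∈ Finset.range (k + 1), (D * u) ^ i / (i.factorial : ℂ))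
  have hd : ∀ u ∈ Set.Ici (0:ℝ), HasDerivAt F ((u : ℂ) ^ k * Complex.exp (-(D * u))) u := by
    intro u _
    have h1 : HasDerivAt (fun u : ℝ => D * (u : ℂ)) D u := by
      simpa using (Complex.ofRealCLM.hasDerivAt (x := u)).const_mul D
    have h2 := ((hasDerivAt_cexp_neg_mul_sum k (D * u)).comp u h1).const_mul
      (-(k.factorial / D ^ (k + 1) : ℂ))
    convert! h2 using 1
    field_simp
    ring
  have ht : Filter.Tendsto F Filter.atTop (nhds 0) := by
    have : ∀ i ∈ Finset.range (k + 1), Filter.Tendsto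
        (fun u : ℝ => -(k.factorial / D ^ (k + 1)) * D ^ i / (i.factorial : ℂ) *
          ((u : ℂ) ^ i * Complex.exp (-(D * u)))) Filter.atTop (nhds 0) := by
      intro i _
      rw [← mul_zero (-(k.factorial / D ^ (k + 1)) * D ^ i / (i.factorial : ℂ))]
      refine Filter.Tendsto.const_mul _ ?_
      rw [tendsto_zero_iff_norm_tendsto_zero]
      have := tendsto_rpow_mul_exp_neg_mul_atTop_nhds_zero (i : ℝ) D.re hD
      refine this.congr' ?_
      filter_upwards [Filter.eventually_gt_atTop 0] with u hu
      simp [Complex.norm_exp, abs_of_pos hu]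
    have h := tendsto_finsetSum _ this
    simp only [Finset.sum_const_zero] at h
    refine h.congr fun u => ?_
    simp only [F, Finset.mul_sum]
    exact Finset.sum_congr rfl fun i _ => by rw [mul_pow]; ring
  rw [integral_Ioi_of_hasDerivAt_of_tendsto' hd (integrableOn_pow_mul_cexp k hD) ht]
  simp [F, Finset.sum_range_succ']

/-- The transform of an exponential gap `u` on the event that a Poisson variable with parameter
`lam * u` equals `k`. -/
theorem integral_exp_mul_poisson (k : ℕ) {lam mu : ℝ} (hlam : 0 < lam) (hmu : 0 < mu) {h : ℂ}
    (hh : 0 ≤ h.re) :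
    ∫ u, Complex.exp (-h * u) * ((Real.exp (-(lam * u)) * (lam * u) ^ k / k.factorial : ℝ) : ℂ)
      ∂(expMeasure mu) = mu * lam ^ k / (mu + lam + h) ^ (k + 1) := by
  have hD : 0 < (mu + lam + h : ℂ).re := by simp; linarith
  have hk : (k.factorial : ℂ) ≠ 0 := by exact_mod_cast k.factorial_ne_zero
  rw [integral_expMeasure hmu]
  have : ∀ u : ℝ, (mu * Real.exp (-(mu * u))) • (Complex.exp (-h * u) *
      ((Real.exp (-(lam * u)) * (lam * u) ^ k / k.factorial : ℝ) : ℂ))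
      = (mu * lam ^ k / k.factorial : ℂ) * ((u : ℂ) ^ k * Complex.exp (-((mu + lam + h) * u))) := by
    intro u
    have : Complex.exp (-((mu + lam + h) * u)) = Complex.exp (-(mu * u)) * Complex.exp (-h * u)
        * Complex.exp (-(lam * u)) := by
      rw [← Complex.exp_add, ← Complex.exp_add]; ring_nf
    rw [this, Complex.real_smul]
    push_cast
    ring
  simp only [this]
  rw [integral_const_mul, integral_pow_mul_cexp k hD]
  field_simp

theorem integral_cexp_expMeasure {mu : ℝ} (hmu : 0 < mu) {h : ℂ} (hh : 0 ≤ h.re) :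
    ∫ u : ℝ, Complex.exp (-h * u) ∂(expMeasure mu) = mu / (mu + h) := by
  have hD : 0 < (mu + h : ℂ).re := by simp; linarith
  rw [integral_expMeasure hmu]
  have : ∀ u : ℝ, (mu * Real.exp (-(mu * u))) • (Complex.exp (-h * u))
      = (mu : ℂ) * ((u : ℂ) ^ 0 * Complex.exp (-((mu + h) * u))) := by
    intro u
    have : Complex.exp (-((mu + h) * u)) = Complex.exp (-(mu * u)) * Complex.exp (-h * u) := by
      rw [← Complex.exp_add]; ring_nf
    rw [this, Complex.real_smul]
    push_cast
    ring
  simp only [this]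
  rw [integral_const_mul, integral_pow_mul_cexp 0 hD]
  simp [div_eq_mul_inv]

/-- Convolving an Erlang distribution function with an exponential density adds one phase. -/
theorem integral_erlangCdf (m : ℕ) {r : ℝ} (hr : 0 < r) (x : ℝ) :
    ∫ u in (0:ℝ)..x, r * Real.exp (-(r * u)) * erlangCdf m (r * (x - u))
      = erlangCdf (m + 1) (r * x) := by
  let F : ℝ → ℝ := fun u => -Real.exp (-(r * u)) + Real.exp (-(r * x)) *
    ∑ i ∈ Finset.range m, (r * (x - u)) ^ (i + 1) / ((i + 1).factorial : ℝ)
  have hd : ∀ u ∈ Set.uIcc 0 x,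
      HasDerivAt F (r * Real.exp (-(r * u)) * erlangCdf m (r * (x - u))) u := by
    intro u _
    have h1 : HasDerivAt (fun u : ℝ => -Real.exp (-(r * u))) (r * Real.exp (-(r * u))) u :=
      hasDerivAt_neg_exp_mul_exp
    have h2 : HasDerivAt (fun u : ℝ => r * (x - u)) (-r) u := by
      simpa using ((hasDerivAt_id u).const_sub x).const_mul r
    have h3 : HasDerivAt (fun u : ℝ => ∑ i ∈ Finset.range m,
        (r * (x - u)) ^ (i + 1) / ((i + 1).factorial : ℝ))
        (∑ i ∈ Finset.range m, -r * ((r * (x - u)) ^ i / (i.factorial : ℝ))) u := by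
      refine HasDerivAt.fun_sum fun i _ => ?_
      convert! (h2.pow (i + 1)).div_const ((i + 1).factorial : ℝ) using 1
      rw [Nat.factorial_succ]; push_cast
      have : (i.factorial : ℝ) ≠ 0 := by positivity
      field_simp
    convert! h1.add (h3.const_mul (Real.exp (-(r * x)))) using 1
    rw [erlangCdf, ← Finset.mul_sum]
    have : Real.exp (-(r * x)) = Real.exp (-(r * u)) * Real.exp (-(r * (x - u))) := by
      rw [← Real.exp_add]; ring_nf
    rw [this]; ring
  rw [intervalIntegral.integral_eq_sub_of_hasDerivAt hd]
  · simp only [F, erlangCdf, Finset.sum_range_succ']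
    simp
    ring
  · apply Continuous.intervalIntegrable
    unfold erlangCdf
    fun_prop

theorem measureReal_sum_exp_le [MeasurableSpace Ω] {P : Measure Ω} [IsProbabilityMeasure P]
    {ι : Type*} {w : ι → Ω → ℝ} {r : ℝ} (hr : 0 < r) (hw : ∀ i, Measurable (w i))
    (hlaw : ∀ i, P.map (w i) = expMeasure r) (hind : iIndepFun w P) (F : Finset ι) (x : ℝ) :
    P.real {ω | ∑ i ∈ F, w i ω ≤ x} = if 0 ≤ x then erlangCdf F.card (r * x) else 0 := by
  classical
  induction F using Finset.induction_on generalizing x with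
  | empty =>
    by_cases hx : 0 ≤ x
    · simp [hx, erlangCdf]
    · simp [hx]
  | insert a F ha ih =>
    have hS : Measurable fun ω => ∑ i ∈ F, w i ω := Finset.measurable_fun_sum _ fun i _ => hw i
    have hi : IndepFun (fun ω => ∑ i ∈ F, w i ω) (w a) P := by
      have := hind.indepFun_finsetSum_of_notMem hw ha
      rwa [Finset.sum_fn] at this
    let C : Set (ℝ × ℝ) := {p | p.1 + p.2 ≤ x}
    have hC : MeasurableSet C := measurableSet_le (by fun_prop) (by fun_prop)
    let q : ℝ → ℝ := fun u => if 0 ≤ x - u then erlangCdf F.card (r * (x - u)) else 0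
    have key := setIntegral_of_indepFun (P := P) hS (hw a) hi hC (g := fun _ => 1) (by fun_prop)
      (by simp) (q := q) (Filter.Eventually.of_forall fun ω => by
        simp only [q, ← ih]
        congr 1; ext ω'; simp [C, le_sub_iff_add_le])
    have hqm : Measurable q := by
      refine Measurable.ite (measurableSet_le (by fun_prop) (by fun_prop)) ?_ (by fun_prop)
      unfold erlangCdf; fun_prop
    have hset : {ω | ∑ i ∈ insert a F, w i ω ≤ x} = {ω | (∑ i ∈ F, w i ω, w a ω) ∈ C} := by
      ext ω; simp [C, Finset.sum_insert ha, add_comm]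
    have h2 : P.real {ω | ∑ i ∈ insert a F, w i ω ≤ x} = ∫ ω, q (w a ω) ∂P := by
      rw [hset]
      rw [setIntegral_const] at key
      simp only [one_mul] at key
      rw [integral_complex_ofReal] at key
      simpa using key
    rw [h2, ← integral_map (hw a).aemeasurable hqm.aestronglyMeasurable, hlaw a,
      integral_expMeasure hr, Finset.card_insert_of_notMem ha]
    have hq' : ∀ u, (r * Real.exp (-(r * u))) • q u = (Set.Iic x).indicator
        (fun u => r * Real.exp (-(r * u)) * erlangCdf F.card (r * (x - u))) u := by
      intro u
      by_cases hu : u ≤ x <;> simp [q, hu]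
    simp only [hq']
    rw [setIntegral_indicator measurableSet_Iic, Set.Ioi_inter_Iic]
    split_ifs with hx
    · rw [← intervalIntegral.integral_of_le hx, integral_erlangCdf _ hr x]
    · rw [Set.Ioc_eq_empty (by linarith)]; simp

/-! ### The transform of a window as a rational power series -/

/-- The generating function `∑_{m ≥ 1} a (1 - a)^(m - 1) X^m` of a batch size. -/
def batchSeries (a : ℝ) : PowerSeries ℝ :=
  PowerSeries.mk fun m => if m = 0 then 0 else a * (1 - a) ^ (m - 1)

theorem coeff_batchSeries_pow_of_lt (a : ℝ) {k x : ℕ} (h : x < k) :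
    PowerSeries.coeff x (batchSeries a ^ k) = 0 := by
  have hX : PowerSeries.X ∣ batchSeries a :=
    PowerSeries.X_dvd_iff.2 (by simp [batchSeries, ← PowerSeries.coeff_zero_eq_constantCoeff_apply])
  exact PowerSeries.X_pow_dvd_iff.1 (pow_dvd_pow_of_dvd hX k) x h

theorem one_sub_mul_batchSeries (a : ℝ) :
    (1 - PowerSeries.C (1 - a) * PowerSeries.X) * batchSeries a = PowerSeries.C a * PowerSeries.X := by
  ext n
  rcases n with _ | _ | n
  · simp [batchSeries, sub_mul]
  · simp [batchSeries, sub_mul, mul_assoc, PowerSeries.coeff_succ_X_mul]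
  · simp [batchSeries, sub_mul, mul_assoc, PowerSeries.coeff_succ_X_mul]
    ring

/-- The coefficient `E[exp (-h Δ); X = x]`, where `Δ` is an exponential gap with parameter `mu` and
`X` is the number of nodes lost during it: the sum runs over the number `k` of attacks, which is at
most `x` because every batch has at least one node. -/
def windowCoeff (lam mu a : ℝ) (h : ℂ) (x : ℕ) : ℂ :=
  ∑ k ∈ Finset.range (x + 1), mu * lam ^ k / (mu + lam + h) ^ (k + 1) *
    ((PowerSeries.coeff x (batchSeries a ^ k) : ℝ) : ℂ)

/-- The joint transform `∑ₓ E[exp (-h Δ); X = x] Xˣ` of a window, as a formal power series. -/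
def windowSeries (lam mu a : ℝ) (h : ℂ) : PowerSeries ℂ := PowerSeries.mk (windowCoeff lam mu a h)

section algebra
variable {lam mu a : ℝ} {h : ℂ}

/-- The geometric series in the number of attacks, cleared of its denominator. -/
theorem windowSeries_batch (lam mu a : ℝ) (h : ℂ) :
    (1 - PowerSeries.C (lam / (mu + lam + h)) * (batchSeries a).map (algebraMap ℝ ℂ))
      * windowSeries lam mu a h = PowerSeries.C (mu / (mu + lam + h)) := by
  set φ := (batchSeries a).map (algebraMap ℝ ℂ) with hφ
  set q : ℂ := lam / (mu + lam + h)
  have hco : ∀ x k, x < k → PowerSeries.coeff x ((PowerSeries.C q * φ) ^ k) = 0 := by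
    intro x k hk
    rw [mul_pow, ← map_pow, ← map_pow, PowerSeries.coeff_C_mul, PowerSeries.coeff_map,
      coeff_batchSeries_pow_of_lt a hk]
    simp
  ext n
  -- Up to degree `n` the series agrees with the truncated geometric series `T`.
  let T : PowerSeries ℂ := PowerSeries.C (mu / (mu + lam + h)) *
    ∑ k ∈ Finset.range (n + 1), (PowerSeries.C q * φ) ^ k
  have hT : ∀ x ≤ n, PowerSeries.coeff x (windowSeries lam mu a h) = PowerSeries.coeff x T := by
    intro x hx
    rw [PowerSeries.coeff_C_mul, map_sum, windowSeries, PowerSeries.coeff_mk, windowCoeff,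
      ← Finset.sum_subset (Finset.range_mono (Nat.succ_le_succ hx))
        (fun k _ hk => hco x k (by rw [Finset.mem_range] at hk; omega)), Finset.mul_sum]
    refine Finset.sum_congr rfl fun k _ => ?_
    rw [mul_pow, ← map_pow, ← map_pow, PowerSeries.coeff_C_mul, PowerSeries.coeff_map]
    simp only [q, div_eq_mul_inv, mul_pow, inv_pow, pow_succ, mul_inv, Complex.coe_algebraMap]
    ring
  have h1 : PowerSeries.coeff n ((1 - PowerSeries.C q * φ) * windowSeries lam mu a h)
      = PowerSeries.coeff n ((1 - PowerSeries.C q * φ) * T) := by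
    rw [PowerSeries.coeff_mul, PowerSeries.coeff_mul]
    refine Finset.sum_congr rfl fun p hp => ?_
    rw [hT _ ((by rw [Finset.HasAntidiagonal.mem_antidiagonal] at hp; omega : p.2 ≤ n))]
  have h2 : (1 - PowerSeries.C q * φ) * T
      = PowerSeries.C (mu / (mu + lam + h)) * (1 - (PowerSeries.C q * φ) ^ (n + 1)) := by
    rw [← mul_neg_geom_sum]; ring
  rw [h1, h2, PowerSeries.coeff_C_mul, map_sub, hco n (n + 1) (Nat.lt_succ_self n)]
  by_cases hn : n = 0 <;> simp [PowerSeries.coeff_one, PowerSeries.coeff_C, hn]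

/-- The window transform is the rational function
`(mu / (mu + lam + h)) (1 - (1 - a) X) / (1 - d(h) X)`. -/
theorem windowSeries_rational (hD : (mu + lam + h : ℂ) ≠ 0) :
    (1 - PowerSeries.C (dFun lam mu a h) * PowerSeries.X) * windowSeries lam mu a h
      = PowerSeries.C (mu / (mu + lam + h)) * (1 - PowerSeries.C (1 - a : ℂ) * PowerSeries.X) := by
  have h1 := windowSeries_batch lam mu a h
  have h2 := congrArg (PowerSeries.map (algebraMap ℝ ℂ)) (one_sub_mul_batchSeries a)
  simp only [map_mul, map_sub, map_one, PowerSeries.map_C, PowerSeries.map_X,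
    Complex.coe_algebraMap] at h2
  have h3 : PowerSeries.C (dFun lam mu a h)
      = PowerSeries.C (1 - a : ℂ) + PowerSeries.C (lam / (mu + lam + h)) * PowerSeries.C (a : ℂ) := by
    rw [← map_mul, ← map_add]
    congr 1
    have hD' : (lam + mu + h : ℂ) ≠ 0 := by rwa [add_comm (lam : ℂ)]
    rw [dFun, div_mul_eq_mul_div, eq_comm, add_comm (mu : ℂ), ← eq_sub_iff_add_eq', div_sub' hD']
    congr 1
    ring
  rw [h3, ← h1]
  simp only [map_sub, map_one]
  linear_combination (PowerSeries.C (lam / (mu + lam + h)) * windowSeries lam mu a h) * h2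

theorem windowCoeff_zero : windowCoeff lam mu a h 0 = mu / (mu + lam + h) := by
  simp [windowCoeff]

theorem windowCoeff_succ (hD : (mu + lam + h : ℂ) ≠ 0) (x : ℕ) :
    windowCoeff lam mu a h (x + 1)
      = mu / (mu + lam + h) * (a * lam / (mu + lam + h)) * dFun lam mu a h ^ x := by
  have hco := fun n => congrArg (PowerSeries.coeff n) (windowSeries_rational (a := a) hD)
  induction x with
  | zero =>
    have := hco 1
    simp [sub_mul, mul_assoc, PowerSeries.coeff_succ_X_mul, windowSeries,
      windowCoeff_zero, mul_sub] at this
    have hD' : (lam + mu + h : ℂ) ≠ 0 := by rwa [add_comm (lam : ℂ)]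
    rw [sub_eq_iff_eq_add] at this
    rw [zero_add, this, dFun, add_comm (lam : ℂ) mu]
    field_simp
    ring
  | succ x ih =>
    have := hco (x + 2)
    simp [sub_mul, mul_assoc, PowerSeries.coeff_succ_X_mul, windowSeries, ih, mul_sub] at this
    rw [sub_eq_iff_eq_add] at this
    rw [this]; ring

end algebra

/-! ### The renewal equation and its solution -/

/-- Abel summation. The recursion for `u` says that its generating function is
`(1 - X) / ((1 - d X) (1 - c X))`. -/
theorem sum_icc_telescope {c d : ℂ} (hc : c ≠ 0) (hd : d ≠ 0) {Q G : ℕ → ℂ}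
    (hQ : ∀ m, Q m - d * Q (m + 1) = (1 - d) * G (m + 1)) {u : ℕ → ℂ} (h0 : u 0 = 1)
    (hu : ∀ j, u (j + 1) = d * u j + (c - 1) * c ^ j) (m K : ℕ) :
    Q m + (c - 1) / c * ∑ j ∈ Finset.Icc 1 K, c ^ j * Q (m + j)
      - d ^ (K + 1) * (1 + (c - 1) / c * ∑ i ∈ Finset.Icc 1 K, (c / d) ^ i) * Q (m + K + 1)
      = (1 - d) * ∑ j ∈ Finset.range (K + 1), u j * G (m + 1 + j) := by
  have hS : ∀ K, u K = d ^ K * (1 + (c - 1) / c * ∑ i ∈ Finset.Icc 1 K, (c / d) ^ i) := by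
    intro K
    induction K with
    | zero => simp [h0]
    | succ K ih =>
      rw [hu, ih, Finset.sum_Icc_succ_top (by omega), div_pow]
      field_simp
      ring
  induction K with
  | zero =>
    have := hQ m
    simp [h0]
    linear_combination this
  | succ K ih =>
    have h1 := hS K
    have h2 := hS (K + 1)
    have h3 := hQ (m + K + 1)
    have h4 := hu K
    rw [Finset.sum_range_succ, mul_add (1 - d), ← ih, Finset.sum_Icc_succ_top (by omega)]
    have e1 : m + 1 + (K + 1) = m + K + 1 + 1 := by ring
    have e2 : m + (K + 1) = m + K + 1 := by ring
    rw [e1, e2]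
    have h5 : (c - 1) / c * (c ^ (K + 1) * Q (m + K + 1)) = (c - 1) * c ^ K * Q (m + K + 1) := by
      rw [pow_succ]; field_simp
    set S := ∑ i ∈ Finset.Icc 1 K, (c / d) ^ i
    set S' := ∑ i ∈ Finset.Icc 1 (K + 1), (c / d) ^ i
    set T := ∑ i ∈ Finset.Icc 1 K, c ^ i * Q (m + i)
    have e3 : d ^ (K + 1 + 1) * (1 + (c - 1) / c * S') = d * u (K + 1) := by rw [h2]; ring
    have e4 : d ^ (K + 1) * (1 + (c - 1) / c * S) = d * u K := by rw [h1]; ring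
    rw [e3, e4, mul_add, h5]
    linear_combination u (K + 1) * h3 - Q (m + K + 1) * h4

section
variable {lam mu a : ℝ} {h : ℂ}

theorem lam_add_mu_add_ne (hlam : 0 < lam) (hmu : 0 < mu) (hh : 0 ≤ h.re) :
    (mu + lam + h : ℂ) ≠ 0 := by
  intro h0
  have := congrArg Complex.re h0
  simp at this; linarith

theorem ofReal_add_ne (hlam : 0 < lam) (hh : 0 ≤ h.re) : (lam + h : ℂ) ≠ 0 := by
  intro h0
  have := congrArg Complex.re h0
  simp at this; linarith

theorem cFun_ne_zero (hlam : 0 < lam) (ha' : a ≤ 1) (hh : 0 ≤ h.re) : cFun lam a h ≠ 0 := by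
  refine div_ne_zero ?_ (ofReal_add_ne hlam hh)
  intro h0
  have := congrArg Complex.re h0
  simp at this
  nlinarith [mul_nonneg (sub_nonneg.2 ha') hh]

theorem dFun_zero_ne_zero (hlam : 0 < lam) (hmu : 0 < mu) (ha' : a ≤ 1) :
    dFun lam mu a 0 ≠ 0 := by
  have h1 : lam + (1 - a) * mu ≠ 0 := by
    nlinarith [mul_nonneg (sub_nonneg.2 ha') hmu.le]
  have h2 : lam + mu ≠ 0 := by positivity
  simp only [dFun, add_zero]
  exact div_ne_zero (by exact_mod_cast h1) (by exact_mod_cast h2)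

theorem one_sub_dFun_zero (hlam : 0 < lam) (hmu : 0 < mu) :
    1 - dFun lam mu a 0 = a * mu / (mu + lam) := by
  have h2 : (lam + mu : ℂ) ≠ 0 := by exact_mod_cast (by positivity : lam + mu ≠ 0)
  have h3 : (mu + lam : ℂ) ≠ 0 := by rwa [add_comm]
  simp only [dFun, add_zero]
  field_simp
  ring

theorem one_sub_dFun_mul_one_sub_windowSeries (hlam : 0 < lam) (hmu : 0 < mu) (hh : 0 ≤ h.re) :
    (1 - PowerSeries.C (dFun lam mu a h) * PowerSeries.X) * (1 - windowSeries lam mu a h)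
      = PowerSeries.C ((lam + h) / (mu + lam + h))
        * (1 - PowerSeries.C (cFun lam a h) * PowerSeries.X) := by
  have hD := lam_add_mu_add_ne hlam hmu hh
  have hD' : (lam + mu + h : ℂ) ≠ 0 := by rwa [add_comm (lam : ℂ)]
  have hL := ofReal_add_ne hlam hh
  rw [mul_sub, windowSeries_rational hD, mul_one, mul_sub, mul_sub, ← mul_assoc, ← mul_assoc,
    ← map_mul, ← map_mul]
  have e1 : (mu / (mu + lam + h) * (1 - a) : ℂ)
      = dFun lam mu a h - (lam + h) / (mu + lam + h) * cFun lam a h := by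
    rw [dFun, cFun, add_comm (lam : ℂ) mu]; field_simp; ring
  have e2 : (mu / (mu + lam + h) : ℂ) = 1 - (lam + h) / (mu + lam + h) := by field_simp; ring
  rw [e1, e2]
  simp only [map_sub, map_one]
  ring

/-- Up to the level `M₁` the renewal equation is not discounted, and its solution is the expected
number of observations that see exactly `m` lost nodes. -/
theorem renewal_eq (hlam : 0 < lam) (hmu : 0 < mu) {y : ℕ → ℂ} {M₁ : ℕ}
    (hy : ∀ m ≤ M₁, y m = (if m = 0 then 1 else 0)
      + ∑ p ∈ Finset.range (m + 1), y p * windowCoeff lam mu a 0 (m - p)) :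
    ∀ m ≤ M₁, y m = if m = 0 then ((mu + lam) / lam : ℂ) else a * mu / lam := by
  have hml : (mu + lam : ℂ) ≠ 0 := by exact_mod_cast (by positivity : mu + lam ≠ 0)
  have hl : (lam : ℂ) ≠ 0 := by exact_mod_cast hlam.ne'
  have hD := lam_add_mu_add_ne (h := 0) hlam hmu le_rfl
  have h1 : (1 - PowerSeries.C (1:ℂ) * PowerSeries.X) * PowerSeries.mk (1 : ℕ → ℂ) = 1 := by
    have := PowerSeries.mk_one_mul_one_sub_eq_one ℂ
    rw [mul_comm]; simpa using this
  let R : ℕ → ℂ := fun m => if m = 0 then ((mu + lam) / lam : ℂ) else a * mu / lam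
  -- As `c(0) = 1`, the series `1 / (1 - windowSeries)` is a multiple of `(1 - d(0) X) / (1 - X)`.
  have hR : PowerSeries.mk R = 1 + PowerSeries.mk R * windowSeries lam mu a 0 := by
    have h2 := one_sub_dFun_mul_one_sub_windowSeries (a := a) (h := 0) hlam hmu le_rfl
    have hc : cFun lam a 0 = 1 := by simp [cFun, hl]
    rw [hc] at h2
    simp only [add_zero] at h2
    have h3 : PowerSeries.C (lam / (mu + lam) : ℂ) * (1 - PowerSeries.C 1 * PowerSeries.X)
        * PowerSeries.mk R = 1 - PowerSeries.C (dFun lam mu a 0) * PowerSeries.X := by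
      have hd : dFun lam mu a 0 = 1 - a * mu / (mu + lam) := by
        rw [← one_sub_dFun_zero (a := a) hlam hmu]; ring
      rw [hd]
      ext n
      rcases n with _ | _ | n
      · simp [sub_mul, mul_assoc, R]; field_simp
      · simp [sub_mul, mul_assoc, R, PowerSeries.coeff_succ_X_mul, PowerSeries.coeff_one]
        field_simp
      · simp [sub_mul, mul_assoc, R, PowerSeries.coeff_succ_X_mul, PowerSeries.coeff_one,
          PowerSeries.coeff_X]
    have hne : (1 - PowerSeries.C (dFun lam mu a 0) * PowerSeries.X : PowerSeries ℂ) ≠ 0 := by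
      intro h0
      have := congrArg (PowerSeries.coeff 0) h0
      simp at this
    apply mul_left_cancel₀ hne
    linear_combination h3 + PowerSeries.mk R * h2
  intro m
  induction m using Nat.strong_induction_on with
  | _ m ih =>
    intro hm
    have h1 := hy m hm
    have h2 := congrArg (PowerSeries.coeff m) hR
    rw [map_add, PowerSeries.coeff_mul, Finset.Nat.sum_antidiagonal_eq_sum_range_succ_mk] at h2
    simp only [windowSeries, PowerSeries.coeff_mk, PowerSeries.coeff_one] at h2
    rw [Finset.sum_range_succ] at h1 h2
    have h3 : ∑ p ∈ Finset.range m, y p * windowCoeff lam mu a 0 (m - p)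
        = ∑ p ∈ Finset.range m, R p * windowCoeff lam mu a 0 (m - p) := by
      refine Finset.sum_congr rfl fun p hp => ?_
      rw [Finset.mem_range] at hp
      rw [ih p hp (by omega)]
    rw [h3] at h1
    rw [Nat.sub_self, windowCoeff_zero] at h1 h2
    have h4 : (y m - R m) * (1 - mu / (mu + lam + 0)) = 0 := by linear_combination h1 - h2
    have h5 : (1 - mu / (mu + lam + 0) : ℂ) ≠ 0 := by
      rw [add_zero, one_sub_div hml, add_sub_cancel_left]
      exact div_ne_zero hl hml
    exact sub_eq_zero.1 ((mul_eq_zero.1 h4).resolve_right h5)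

/-- Past the level `M₁` the solution of the discounted renewal equation enters the answer only
through the combination on the left, whose generating function is a multiple of
`(1 - X) / ((1 - d(0) X) (1 - c(h) X))`. -/
theorem sum_renewal_eq (hlam : 0 < lam) (hmu : 0 < mu) (hh : 0 ≤ h.re) {y : ℕ → ℂ} {M₁ : ℕ}
    (hy : ∀ m, y m = (if m = 0 then 1 else 0) + ∑ p ∈ Finset.range (m + 1),
      y p * windowCoeff lam mu a (if M₁ < p then h else 0) (m - p)) (u : ℕ → ℂ) (h0 : u 0 = 1)
    (hu : ∀ j, u (j + 1) = dFun lam mu a 0 * u j + (cFun lam a h - 1) * cFun lam a h ^ j) (j : ℕ) :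
    mu / (mu + h) * y (M₁ + 1 + j)
      - ∑ p ∈ Finset.range (j + 1), y (M₁ + 1 + p) * windowCoeff lam mu a h (j - p)
      = a * mu ^ 2 * lam / ((mu + lam) * (mu + h) * (h + lam)) * u j := by
  have hml : (mu + lam : ℂ) ≠ 0 := by exact_mod_cast (by positivity : mu + lam ≠ 0)
  have hl : (lam : ℂ) ≠ 0 := by exact_mod_cast hlam.ne'
  have hD0 := lam_add_mu_add_ne (h := 0) hlam hmu le_rfl
  have hD := lam_add_mu_add_ne (h := h) hlam hmu hh
  have hL := ofReal_add_ne hlam hh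
  have hU := ofReal_add_ne hmu hh
  set c := cFun lam a h with hc
  set d := dFun lam mu a 0 with hd
  have hy1 := renewal_eq (y := y) (M₁ := M₁) (a := a) hlam hmu (fun m hm => by
    rw [hy m]
    congr 1
    refine Finset.sum_congr rfl fun p hp => ?_
    rw [Finset.mem_range] at hp
    rw [if_neg (by omega)])
  -- `A j` is the probability that the first observation beyond `M₁` sees `M₁ + 1 + j` nodes.
  let A : ℕ → ℂ := fun j => ∑ p ∈ Finset.range (M₁ + 1),
    y p * windowCoeff lam mu a 0 (M₁ + 1 + j - p)
  -- The sum does not depend on `N`: the loss by the factor `d` is made up by the new term `y N`.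
  have hyd : ∀ N ≤ M₁, ∑ p ∈ Finset.range (N + 1), y p * d ^ (N - p) = (mu + lam) / lam := by
    intro N
    induction N with
    | zero => intro _; simp [hy1]
    | succ N ih =>
      intro hN
      rw [Finset.sum_range_succ, hy1 _ hN, if_neg (by omega), Nat.sub_self, pow_zero, mul_one]
      have : ∑ p ∈ Finset.range (N + 1), y p * d ^ (N + 1 - p) = d * ((mu + lam) / lam) := by
        rw [← ih (by omega), Finset.mul_sum]
        refine Finset.sum_congr rfl fun p hp => ?_
        rw [Finset.mem_range] at hp
        rw [Nat.sub_add_comm (by omega), pow_succ]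
        ring
      have hd1 : d = 1 - a * mu / (mu + lam) := by
        rw [← one_sub_dFun_zero (a := a) hlam hmu]; ring
      rw [this, hd1]
      field_simp
      ring
  have hA : ∀ j, A j = (1 - d) * d ^ j := by
    intro j
    have : A j = ∑ p ∈ Finset.range (M₁ + 1), mu / (mu + lam) * (a * lam / (mu + lam)) * d ^ j
        * (y p * d ^ (M₁ - p)) := by
      refine Finset.sum_congr rfl fun p hp => ?_
      rw [Finset.mem_range] at hp
      rw [show M₁ + 1 + j - p = (j + (M₁ - p)) + 1 by omega, windowCoeff_succ hD0, add_zero, pow_add]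
      ring
    rw [this, ← Finset.mul_sum, hyd M₁ le_rfl, hd, one_sub_dFun_zero hlam hmu]
    field_simp
  have hyA : ∀ j, y (M₁ + 1 + j) = A j + ∑ p ∈ Finset.range (j + 1),
      y (M₁ + 1 + p) * windowCoeff lam mu a h (j - p) := by
    intro j
    rw [hy, if_neg (by omega), zero_add, show M₁ + 1 + j + 1 = (M₁ + 1) + (j + 1) by ring,
      Finset.sum_range_add]
    congr 1
    · refine Finset.sum_congr rfl fun p hp => ?_
      rw [Finset.mem_range] at hp
      rw [if_neg (by omega)]
    · refine Finset.sum_congr rfl fun p _ => ?_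
      rw [if_pos (by omega)]
      congr 2
      omega
  let T : ℕ → ℂ := fun j => mu / (mu + h) * y (M₁ + 1 + j)
      - ∑ p ∈ Finset.range (j + 1), y (M₁ + 1 + p) * windowCoeff lam mu a h (j - p)
  set Y : PowerSeries ℂ := PowerSeries.mk fun j => y (M₁ + 1 + j) with hY
  have hYA : Y = PowerSeries.mk A + Y * windowSeries lam mu a h := by
    ext j
    rw [map_add, PowerSeries.coeff_mul, Finset.Nat.sum_antidiagonal_eq_sum_range_succ_mk]
    simpa [windowSeries, hY] using hyA j
  have hT : PowerSeries.mk T = PowerSeries.C (mu / (mu + h)) * Y - Y * windowSeries lam mu a h := by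
    ext j
    rw [map_sub, PowerSeries.coeff_C_mul, PowerSeries.coeff_mul,
      Finset.Nat.sum_antidiagonal_eq_sum_range_succ_mk]
    simp [windowSeries, hY, T]
  have hAs : (1 - PowerSeries.C d * PowerSeries.X) * PowerSeries.mk A = PowerSeries.C (1 - d) := by
    ext j
    rcases j with _ | j
    · simp [sub_mul, mul_assoc, hA]
    · simp [sub_mul, mul_assoc, hA, PowerSeries.coeff_succ_X_mul]; ring
  -- The coefficients of `(1 - X) / (1 - c X)`.
  let v : ℕ → ℂ := fun j => if j = 0 then 1 else (c - 1) * c ^ (j - 1)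
  have hv : (1 - PowerSeries.C c * PowerSeries.X) * PowerSeries.mk v = 1 - PowerSeries.X := by
    ext j
    rcases j with _ | _ | j
    · simp [sub_mul, mul_assoc, v]
    · simp [sub_mul, mul_assoc, v, PowerSeries.coeff_succ_X_mul, PowerSeries.coeff_one]
    · simp [sub_mul, mul_assoc, v, PowerSeries.coeff_succ_X_mul, PowerSeries.coeff_one,
        PowerSeries.coeff_X]
      ring
  have hw := one_sub_dFun_mul_one_sub_windowSeries (a := a) (h := h) hlam hmu hh
  rw [← hc] at hw
  have hXne : ∀ e : ℂ, (1 - PowerSeries.C e * PowerSeries.X : PowerSeries ℂ) ≠ 0 := by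
    intro e h0
    have := congrArg (PowerSeries.coeff 0) h0
    simp at this
  set κ : ℂ := lam * mu / ((lam + h) * (mu + h)) with hκ
  -- Solving `Y = A + Y * windowSeries` for `Y` expresses the series of `T` by that of `A`.
  have hTr : (1 - PowerSeries.C d * PowerSeries.X) * PowerSeries.mk T
      = PowerSeries.C (κ * (1 - d)) * PowerSeries.mk v := by
    apply mul_left_cancel₀ (hXne c)
    have hYr : PowerSeries.C ((lam + h) / (mu + lam + h)) *
        (1 - PowerSeries.C c * PowerSeries.X) * Y
        = (1 - PowerSeries.C (dFun lam mu a h) * PowerSeries.X) * PowerSeries.mk A := by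
      rw [← hw]
      linear_combination (1 - PowerSeries.C (dFun lam mu a h) * PowerSeries.X) * hYA
    have hTA : PowerSeries.mk T = PowerSeries.mk A - PowerSeries.C (h / (mu + h)) * Y := by
      have : PowerSeries.C (mu / (mu + h) : ℂ) = 1 - PowerSeries.C (h / (mu + h)) := by
        rw [← map_one PowerSeries.C, ← map_sub]; congr 1; field_simp; ring
      rw [hT, this]; linear_combination hYA
    set g : ℂ := h * (mu + lam + h) / ((mu + h) * (lam + h)) with hg
    have hYr' : PowerSeries.C (h / (mu + h)) * (1 - PowerSeries.C c * PowerSeries.X) * Y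
        = PowerSeries.C g * (1 - PowerSeries.C (dFun lam mu a h) * PowerSeries.X)
          * PowerSeries.mk A := by
      have : h / (mu + h) = g * ((lam + h) / (mu + lam + h)) := by rw [hg]; field_simp
      rw [this, map_mul]
      linear_combination PowerSeries.C g * hYr
    -- The two linear polynomials combine to a multiple of `1 - X`, as `1 - g = c - g * d(h)`.
    have hnum : (1 - PowerSeries.C c * PowerSeries.X) - PowerSeries.C g *
        (1 - PowerSeries.C (dFun lam mu a h) * PowerSeries.X)
        = PowerSeries.C κ * (1 - PowerSeries.X) := by
      have e1 : κ = 1 - g := by rw [hκ, hg]; field_simp; ring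
      have e2 : κ = c - g * dFun lam mu a h := by
        have hD' : (lam + mu + h : ℂ) ≠ 0 := by rwa [add_comm (lam : ℂ)]
        rw [hκ, hg, hc, cFun, dFun]; field_simp; ring
      have f1 := congrArg PowerSeries.C e1
      have f2 := congrArg PowerSeries.C e2
      simp only [map_sub, map_one, map_mul] at f1 f2
      linear_combination PowerSeries.X * f2 - f1
    rw [map_mul, ← hAs, hTA]
    linear_combination
      (-PowerSeries.C κ * ((1 - PowerSeries.C d * PowerSeries.X) * PowerSeries.mk A)) * hv
      + (1 - PowerSeries.C d * PowerSeries.X) * PowerSeries.mk A * hnum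
      - (1 - PowerSeries.C d * PowerSeries.X) * hYr'
  have hTu : ∀ j, T j = κ * (1 - d) * u j := by
    intro j
    induction j with
    | zero =>
      have := congrArg (PowerSeries.coeff 0) hTr
      simpa [v, h0, sub_mul, mul_assoc] using this
    | succ j ih =>
      have := congrArg (PowerSeries.coeff (j + 1)) hTr
      simp [v, sub_mul, mul_assoc, PowerSeries.coeff_succ_X_mul, ih] at this
      rw [hu]
      linear_combination this
  have := hTu j
  have hκ' : κ * (1 - d) = a * mu ^ 2 * lam / ((mu + lam) * (mu + h) * (h + lam)) := by
    have hL' : (h + lam : ℂ) ≠ 0 := by rwa [add_comm]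
    rw [hκ, hd, one_sub_dFun_zero hlam hmu]; field_simp; ring
  rw [← hκ', ← this]

end

/-! ### Sums of batches and the counting measures -/

/-- If `A` and `B` are independent and `(A, B)` is independent of `C`, then `A` is independent of
`(B, C)`. -/
theorem indepFun_prodMk_right_of_indepFun [MeasurableSpace Ω] {P : Measure Ω}
    [IsProbabilityMeasure P] {α β γ : Type*} [MeasurableSpace α] [MeasurableSpace β]
    [MeasurableSpace γ] {A : Ω → α} {B : Ω → β} {C : Ω → γ} (hA : Measurable A)
    (hB : Measurable B) (hC : Measurable C) (hAB : IndepFun A B P)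
    (hABC : IndepFun (fun ω => (A ω, B ω)) C P) : IndepFun A (fun ω => (B ω, C ω)) P := by
  have : IsProbabilityMeasure (P.map A) := Measure.isProbabilityMeasure_map hA.aemeasurable
  have : IsProbabilityMeasure (P.map B) := Measure.isProbabilityMeasure_map hB.aemeasurable
  have : IsProbabilityMeasure (P.map C) := Measure.isProbabilityMeasure_map hC.aemeasurable
  have h1 := (indepFun_iff_map_prod_eq_prod_map_map hA.aemeasurable hB.aemeasurable).1 hAB
  have h2 := (indepFun_iff_map_prod_eq_prod_map_map (hA.prodMk hB).aemeasurable
    hC.aemeasurable).1 hABC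
  have hBC : IndepFun B C P := hABC.comp measurable_snd measurable_id
  have h3 := (indepFun_iff_map_prod_eq_prod_map_map hB.aemeasurable hC.aemeasurable).1 hBC
  rw [indepFun_iff_map_prod_eq_prod_map_map hA.aemeasurable (hB.prodMk hC).aemeasurable, h3,
    ← Measure.prodAssoc_prod, ← h1, ← h2, Measure.map_map (by fun_prop) (by fun_prop)]
  rfl

section batches
variable [MeasurableSpace Ω] {P : Measure Ω} [IsProbabilityMeasure P] {a : ℝ} {n : ℕ → Ω → ℕ}

/-- The law prescribed on `{1, 2, …}` has total mass one, so the value `0` is almost surely not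
taken. -/
theorem measureReal_batch_eq (ha : 0 < a) (ha' : a ≤ 1) {X : Ω → ℕ} (hX : Measurable X)
    (hlaw : ∀ m, P {ω | X ω = m + 1} = ENNReal.ofReal (a * (1 - a) ^ m)) (x : ℕ) :
    P.real {ω | X ω = x} = PowerSeries.coeff x (batchSeries a) := by
  have h0 : ∀ m : ℕ, 0 ≤ a * (1 - a) ^ m := fun m =>
    mul_nonneg ha.le (pow_nonneg (sub_nonneg.2 ha') m)
  rcases x with _ | m
  · have hs : HasSum (fun m : ℕ => a * (1 - a) ^ m) 1 := by
      have := (hasSum_geometric_of_lt_one (sub_nonneg.2 ha') (by linarith)).mul_left a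
      rwa [sub_sub_cancel, mul_inv_cancel₀ ha.ne'] at this
    have hU : (⋃ m : ℕ, {ω | X ω = m + 1}) = {ω | X ω = 0}ᶜ := by
      ext ω
      simp only [Set.mem_iUnion, Set.mem_ofPred_eq, Set.mem_compl_iff]
      exact ⟨fun ⟨m, hm⟩ => by omega, fun h => ⟨X ω - 1, by omega⟩⟩
    have hm : ∀ m : ℕ, MeasurableSet {ω | X ω = m} := fun m => hX (measurableSet_singleton m)
    have h1 : P {ω | X ω = 0}ᶜ = 1 := by
      rw [← hU, measure_iUnion (fun i j hij => Set.disjoint_left.2 fun ω hi hj => hij (by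
        simp only [Set.mem_ofPred_eq] at hi hj; omega)) (fun m => hm (m + 1))]
      simp only [hlaw]
      rw [← ENNReal.ofReal_tsum_of_nonneg h0 hs.summable, hs.tsum_eq, ENNReal.ofReal_one]
    have h2 : P {ω | X ω = 0} = 0 := (prob_compl_eq_one_iff (hm 0)).1 h1
    simp [Measure.real, h2, batchSeries]
  · rw [Measure.real, hlaw, ENNReal.toReal_ofReal (h0 m)]
    simp [batchSeries]

theorem measureReal_sum_batch_eq (hn : ∀ k, Measurable (n k)) (hind : iIndepFun n P)
    (hlaw : ∀ k x, P.real {ω | n k ω = x} = PowerSeries.coeff x (batchSeries a))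
    (F : Finset ℕ) (x : ℕ) :
    P.real {ω | ∑ k ∈ F, n k ω = x} = PowerSeries.coeff x (batchSeries a ^ F.card) := by
  classical
  induction F using Finset.induction_on generalizing x with
  | empty =>
    by_cases hx : x = 0
    · simp [hx]
    · have : ¬ (0 = x) := fun h => hx h.symm
      simp [this, hx, PowerSeries.coeff_one]
  | insert k F hk ih =>
    have hS : Measurable fun ω => ∑ i ∈ F, n i ω := Finset.measurable_fun_sum _ fun i _ => hn i
    have hi : IndepFun (n k) (fun ω => ∑ i ∈ F, n i ω) P := by
      have := hind.indepFun_finsetSum_of_notMem hn hk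
      rw [Finset.sum_fn] at this
      exact this.symm
    rw [Finset.card_insert_of_notMem hk, pow_succ', PowerSeries.coeff_mul]
    have hU : {ω | ∑ i ∈ insert k F, n i ω = x} = ⋃ p ∈ Finset.HasAntidiagonal.antidiagonal x,
        ({ω | n k ω = p.1} ∩ {ω | ∑ i ∈ F, n i ω = p.2}) := by
      ext ω
      simp [Finset.sum_insert hk]
    rw [hU, measureReal_biUnion_finset]
    · refine Finset.sum_congr rfl fun p _ => ?_
      rw [← hlaw k, ← ih, measureReal_def, measureReal_def, measureReal_def, ← ENNReal.toReal_mul]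
      congr 1
      exact hi.measure_inter_preimage_eq_mul {p.1} {p.2} (measurableSet_singleton _)
        (measurableSet_singleton _)
    · intro p _ p' _ hpp
      refine Set.disjoint_left.2 fun ω h1 h2 => hpp ?_
      simp only [Set.mem_inter_iff, Set.mem_ofPred_eq] at h1 h2
      exact Prod.ext (h1.1.symm.trans h2.1) (h1.2.symm.trans h2.2)
    · intro p _
      exact (hn k (measurableSet_singleton _)).inter (hS (measurableSet_singleton _))

/-- Sums of independent batches over disjoint finite sets of attacks are independent. -/
theorem measureReal_forall_sum_eq (hn : ∀ k, Measurable (n k)) (hind : iIndepFun n P)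
    (s : Finset ℕ) (F : ℕ → Finset ℕ) (hF : Pairwise fun i j => Disjoint (F i) (F j))
    (x : ℕ → ℕ) :
    P.real {ω | ∀ i ∈ s, ∑ k ∈ F i, n k ω = x i}
      = ∏ i ∈ s, P.real {ω | ∑ k ∈ F i, n k ω = x i} := by
  classical
  induction s using Finset.induction_on with
  | empty => simp
  | insert j s hj ih =>
    have hd : Disjoint (F j) (s.biUnion F) := by
      rw [Finset.disjoint_biUnion_right]
      exact fun i hi => hF (by rintro rfl; exact hj hi)
    have h1 := hind.indepFun_finset (F j) (s.biUnion F) hd hn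
    let A : Set (↥(F j) → ℕ) := {z | ∑ k, z k = x j}
    let B : Set (↥(s.biUnion F) → ℕ) :=
      {z | ∀ i (hi : i ∈ s), ∑ k : ↥(F i),
        z ⟨k, Finset.mem_biUnion.2 ⟨i, hi, k.2⟩⟩ = x i}
    have h2 := h1.measure_inter_preimage_eq_mul A B (Set.to_countable A).measurableSet
      (Set.to_countable B).measurableSet
    have eA : (fun ω (i : ↥(F j)) => n i ω) ⁻¹' A = {ω | ∑ k ∈ F j, n k ω = x j} := by
      ext ω
      simp only [A, Set.mem_preimage, Set.mem_ofPred_eq]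
      rw [Finset.sum_coe_sort (F j) (fun k => n k ω)]
    have eB : (fun ω (i : ↥(s.biUnion F)) => n i ω) ⁻¹' B
        = {ω | ∀ i ∈ s, ∑ k ∈ F i, n k ω = x i} := by
      ext ω
      simp only [B, Set.mem_preimage, Set.mem_ofPred_eq]
      refine forall₂_congr fun i _ => ?_
      rw [Finset.sum_coe_sort (F i) (fun k => n k ω)]
    rw [eA, eB] at h2
    rw [Finset.prod_insert hj, ← ih, measureReal_def, measureReal_def, measureReal_def,
      ← ENNReal.toReal_mul, ← h2]
    congr 2
    ext ω
    simp

end batches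

section counting
variable {t : ℕ → Ω → ℝ} {n : ℕ → Ω → ℕ} {w : ℕ → ℕ → Ω → ℝ} {τ : ℕ → Ω → ℝ} {ω : Ω} {B : Set ℝ}

theorem attackMeasure_apply (hB : MeasurableSet B) :
    attackMeasure t ω B = ∑' k, B.indicator 1 (t k ω) := by
  simp [attackMeasure, Measure.sum_apply _ hB, Measure.dirac_apply' _ hB]

theorem nodeMeasure_apply (hB : MeasurableSet B) :
    nodeMeasure t n ω B = ∑' k, (n k ω : ENNReal) * B.indicator 1 (t k ω) := by
  simp [nodeMeasure, Measure.sum_apply _ hB, Measure.dirac_apply' _ hB]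

theorem weightMeasure_apply (hB : MeasurableSet B) :
    weightMeasure t n w ω B = ∑' k, ENNReal.ofReal (∑ j ∈ Finset.range (n k ω), w k j ω)
      * B.indicator 1 (t k ω) := by
  simp [weightMeasure, Measure.sum_apply _ hB, Measure.dirac_apply' _ hB]

theorem attackMeasure_eq_card (hB : MeasurableSet B) (hf : {k | t k ω ∈ B}.Finite) :
    attackMeasure t ω B = hf.toFinset.card := by
  rw [attackMeasure_apply hB, tsum_eq_sum (s := hf.toFinset) (fun k hk => by simpa using hk)]
  rw [Finset.sum_congr rfl (g := fun _ => 1) (fun k hk => by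
    have : t k ω ∈ B := by simpa using hk
    simp [this])]
  simp

theorem nodeMeasure_eq_sum (hB : MeasurableSet B) (hf : {k | t k ω ∈ B}.Finite) :
    nodeMeasure t n ω B = ((∑ k ∈ hf.toFinset, n k ω : ℕ) : ENNReal) := by
  rw [nodeMeasure_apply hB, tsum_eq_sum (s := hf.toFinset) (fun k hk => by
    have : t k ω ∉ B := by simpa using hk
    simp [this]), Nat.cast_sum]
  refine Finset.sum_congr rfl (fun k hk => ?_)
  have : t k ω ∈ B := by simpa using hk
  simp [this]

theorem weightMeasure_eq_sum (hB : MeasurableSet B) (hf : {k | t k ω ∈ B}.Finite) :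
    weightMeasure t n w ω B
      = ∑ k ∈ hf.toFinset, ENNReal.ofReal (∑ j ∈ Finset.range (n k ω), w k j ω) := by
  rw [weightMeasure_apply hB, tsum_eq_sum (s := hf.toFinset) (fun k hk => by
    have : t k ω ∉ B := by simpa using hk
    simp [this])]
  refine Finset.sum_congr rfl (fun k hk => ?_)
  have : t k ω ∈ B := by simpa using hk
  simp [this]

theorem finite_of_attackMeasure_ne_top (hB : MeasurableSet B) (h : attackMeasure t ω B ≠ ⊤) :
    {k | t k ω ∈ B}.Finite := by
  rw [attackMeasure_apply hB] at h
  refine (ENNReal.finite_const_le_of_tsum_ne_top h one_ne_zero).subset fun k hk => ?_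
  have : t k ω ∈ B := hk
  simp [this]

theorem measurableSet_window (τ : ℕ → Ω → ℝ) (ω : Ω) (i : ℕ) : MeasurableSet (window τ ω i) := by
  cases i
  · exact measurableSet_Icc
  · exact measurableSet_Ioc

variable [MeasurableSpace Ω]

theorem measurable_indicator_window (ht : ∀ k, Measurable (t k)) (hτ : ∀ i, Measurable (τ i))
    (k i : ℕ) :
    Measurable fun ω => (window τ ω i).indicator (1 : ℝ → ENNReal) (t k ω) := by
  have : MeasurableSet {ω | t k ω ∈ window τ ω i} := by
    cases i with
    | zero => exact (measurableSet_le measurable_const (ht k)).inter (measurableSet_le (ht k) (hτ 0))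
    | succ i => exact (measurableSet_lt (hτ i) (ht k)).inter (measurableSet_le (ht k) (hτ (i + 1)))
  exact (measurable_const (a := (1 : ENNReal))).indicator this

theorem measurable_attackMeasure_window (ht : ∀ k, Measurable (t k)) (hτ : ∀ i, Measurable (τ i))
    (i : ℕ) : Measurable fun ω => attackMeasure t ω (window τ ω i) := by
  simp only [attackMeasure_apply (measurableSet_window τ _ i)]
  exact Measurable.tsum fun k => measurable_indicator_window ht hτ k i

theorem measurable_nodeMeasure_window (ht : ∀ k, Measurable (t k)) (hτ : ∀ i, Measurable (τ i))
    (hn : ∀ k, Measurable (n k)) (i : ℕ) :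
    Measurable fun ω => nodeMeasure t n ω (window τ ω i) := by
  simp only [nodeMeasure_apply (measurableSet_window τ _ i)]
  exact Measurable.tsum fun k =>
    (measurable_from_top.comp (hn k)).mul (measurable_indicator_window ht hτ k i)

theorem measurable_weightMeasure_window (ht : ∀ k, Measurable (t k)) (hτ : ∀ i, Measurable (τ i))
    (hn : ∀ k, Measurable (n k)) (hw : ∀ k j, Measurable (w k j)) (i : ℕ) :
    Measurable fun ω => weightMeasure t n w ω (window τ ω i) := by
  simp only [weightMeasure_apply (measurableSet_window τ _ i)]
  refine Measurable.tsum fun k =>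
    (Measurable.ennreal_ofReal ?_).mul (measurable_indicator_window ht hτ k i)
  have h1 : Measurable fun p : ℕ × Ω => ∑ j ∈ Finset.range p.1, w k j p.2 :=
    measurable_from_prod_countable_right fun m =>
      Finset.measurable_fun_sum (Finset.range m) fun j _ => hw k j
  exact h1.comp ((hn k).prodMk measurable_id)

end counting

/-! ### Regular paths and Poisson counts in the windows -/

/-- The number of attacks in `(τ_i, τ_{i+1}]`, as a natural number. The junk value `0` is taken where
the count is infinite, which has probability zero. -/
def attackCount (t τ : ℕ → Ω → ℝ) (i : ℕ) (ω : Ω) : ℕ :=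
  ⌊(attackMeasure t ω (window τ ω (i + 1))).toReal⌋₊

/-- The number of nodes lost in `(τ_i, τ_{i+1}]`, as a natural number. The junk value `0` is taken
where it is infinite, which has probability zero. -/
def nodeCount (t : ℕ → Ω → ℝ) (n : ℕ → Ω → ℕ) (τ : ℕ → Ω → ℝ) (i : ℕ) (ω : Ω) : ℕ :=
  ⌊(nodeMeasure t n ω (window τ ω (i + 1))).toReal⌋₊

/-- The properties of a path, valid almost surely, on which the pathwise arguments rely: the epochs
start at `0` and increase strictly, every window contains finitely many attacks, and there is no
attack at time `0`, so that the initial window `[0, τ₀]` is empty of attacks. -/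
structure IsRegularPath (t τ : ℕ → Ω → ℝ) (ω : Ω) : Prop where
  zero : τ 0 ω = 0
  lt : ∀ i, τ i ω < τ (i + 1) ω
  finite : ∀ i, {k | t k ω ∈ window τ ω i}.Finite
  ne_zero : ∀ k, t k ω ≠ 0

/-- The indices of the attacks in the `i`-th window, on a regular path. -/
def windowAttacks (t τ : ℕ → Ω → ℝ) (ω : Ω) (h : IsRegularPath t τ ω) (i : ℕ) : Finset ℕ :=
  (h.finite i).toFinset

section
variable {t : ℕ → Ω → ℝ} {n : ℕ → Ω → ℕ} {w : ℕ → ℕ → Ω → ℝ} {τ : ℕ → Ω → ℝ} {ω : Ω}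

theorem window_disjoint (h : ∀ i, τ i ω < τ (i + 1) ω) {i j : ℕ} (hij : i ≠ j) :
    Disjoint (window τ ω (i + 1)) (window τ ω (j + 1)) := by
  have hm : StrictMono fun i => τ i ω := strictMono_nat_of_lt_succ h
  have key : ∀ i j, i < j → Disjoint (window τ ω (i + 1)) (window τ ω (j + 1)) := by
    intro i j hij
    refine Set.disjoint_left.2 fun x h1 h2 => ?_
    have : τ (i + 1) ω ≤ τ j ω := hm.monotone hij
    have h1 := h1.2
    have h2 := h2.1
    linarith
  rcases lt_or_gt_of_ne hij with h | h
  · exact key i j h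
  · exact (key j i h).symm

theorem IsRegularPath.disjoint (h : IsRegularPath t τ ω) :
    Pairwise fun i j => Disjoint (windowAttacks t τ ω h (i + 1)) (windowAttacks t τ ω h (j + 1)) := by
  intro i j hij
  refine Finset.disjoint_left.2 fun k h1 h2 => ?_
  simp only [windowAttacks, Set.Finite.mem_toFinset, Set.mem_ofPred_eq] at h1 h2
  exact Set.disjoint_left.1 (window_disjoint h.lt hij) h1 h2

theorem IsRegularPath.attackCount_eq (h : IsRegularPath t τ ω) (i : ℕ) :
    attackCount t τ i ω = (windowAttacks t τ ω h (i + 1)).card := by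
  rw [attackCount, attackMeasure_eq_card (measurableSet_window _ _ _) (h.finite (i + 1))]
  simp [windowAttacks]

theorem IsRegularPath.nodeMeasure_eq (h : IsRegularPath t τ ω) (i : ℕ) :
    nodeMeasure t n ω (window τ ω i) = ((∑ k ∈ windowAttacks t τ ω h i, n k ω : ℕ) : ENNReal) :=
  nodeMeasure_eq_sum (measurableSet_window _ _ _) (h.finite i)

theorem IsRegularPath.nodeCount_eq (h : IsRegularPath t τ ω) (i : ℕ) :
    nodeCount t n τ i ω = ∑ k ∈ windowAttacks t τ ω h (i + 1), n k ω := by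
  rw [nodeCount, h.nodeMeasure_eq, ENNReal.toReal_natCast, Nat.floor_natCast]

theorem IsRegularPath.windowAttacks_zero (h : IsRegularPath t τ ω) :
    windowAttacks t τ ω h 0 = ∅ := by
  ext k
  simp only [windowAttacks, Set.Finite.mem_toFinset, Set.mem_ofPred_eq, window, h.zero,
    Finset.notMem_empty, iff_false, Set.Icc_self, Set.mem_singleton_iff]
  exact h.ne_zero k

variable [MeasurableSpace Ω]

theorem measurable_attackCount (ht : ∀ k, Measurable (t k)) (hτ : ∀ i, Measurable (τ i)) (i : ℕ) :
    Measurable (attackCount t τ i) :=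
  Nat.measurable_floor.comp (measurable_attackMeasure_window ht hτ _).ennreal_toReal

theorem measurable_nodeCount (ht : ∀ k, Measurable (t k)) (hτ : ∀ i, Measurable (τ i))
    (hn : ∀ k, Measurable (n k)) (i : ℕ) : Measurable (nodeCount t n τ i) :=
  Nat.measurable_floor.comp (measurable_nodeMeasure_window ht hτ hn _).ennreal_toReal

variable {P : Measure Ω} {lam : ℝ}

theorem IsPoissonPointProcess.measure_singleton (ht : IsPoissonPointProcess P lam t) {B : Set ℝ}
    (hB : MeasurableSet B) (hB0 : B ⊆ Set.Ici 0) (hBv : volume B < ⊤) (r : ℕ) :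
    P {ω | attackMeasure t ω B = r}
      = poissonMeasure (lam.toNNReal * (volume B).toNNReal) {r} := by
  simpa using ht.law 1 (fun _ => B) (fun _ => hB) (fun _ => hB0) (fun _ => hBv)
    (fun i j hij => absurd (Subsingleton.elim i j) hij) (fun _ => r)

variable [IsProbabilityMeasure P]

theorem IsPoissonPointProcess.ae_finite (ht : IsPoissonPointProcess P lam t) :
    ∀ᵐ ω ∂P, ∀ N : ℕ, {k | t k ω ∈ Set.Icc (0 : ℝ) N}.Finite := by
  rw [ae_all_iff]
  intro N
  have hB : MeasurableSet (Set.Icc (0 : ℝ) N) := measurableSet_Icc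
  have hm : Measurable fun ω => attackMeasure t ω (Set.Icc (0 : ℝ) N) := by
    simp only [attackMeasure_apply hB]
    exact Measurable.tsum fun k => (measurable_one.indicator hB).comp (ht.measurable k)
  have hmr : ∀ r : ℕ, MeasurableSet {ω | attackMeasure t ω (Set.Icc (0 : ℝ) N) = r} :=
    fun r => hm (measurableSet_singleton _)
  have h1 : P (⋃ r : ℕ, {ω | attackMeasure t ω (Set.Icc (0 : ℝ) N) = r}) = 1 := by
    rw [measure_iUnion (fun i j hij => Set.disjoint_left.2 fun ω hi hj => hij (by
      simp only [Set.mem_ofPred_eq] at hi hj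
      exact_mod_cast hi.symm.trans hj)) hmr]
    simp only [ht.measure_singleton hB Set.Icc_subset_Ici_self (by simp)]
    rw [← measure_iUnion (by
      intro i j hij
      simpa using hij) (fun r => measurableSet_singleton r),
      Set.iUnion_of_singleton, measure_univ]
  have h2 : ∀ᵐ ω ∂P, ω ∈ ⋃ r : ℕ, {ω | attackMeasure t ω (Set.Icc (0 : ℝ) N) = r} :=
    (mem_ae_iff_prob_eq_one (MeasurableSet.iUnion hmr)).2 h1
  filter_upwards [h2] with ω hω
  obtain ⟨r, hr⟩ := Set.mem_iUnion.1 hω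
  refine finite_of_attackMeasure_ne_top hB ?_
  rw [show attackMeasure t ω (Set.Icc (0 : ℝ) N) = r from hr]
  exact ENNReal.natCast_ne_top r

theorem IsPoissonPointProcess.ae_ne_zero (ht : IsPoissonPointProcess P lam t) :
    ∀ᵐ ω ∂P, ∀ k, t k ω ≠ 0 := by
  have hB : MeasurableSet ({0} : Set ℝ) := measurableSet_singleton 0
  have hm : Measurable fun ω => attackMeasure t ω {0} := by
    simp only [attackMeasure_apply hB]
    exact Measurable.tsum fun k => (measurable_one.indicator hB).comp (ht.measurable k)
  have h1 : P {ω | attackMeasure t ω {0} = (0 : ℕ)} = 1 := by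
    rw [ht.measure_singleton hB (by simp) (by simp)]
    simp [poissonMeasure_singleton]
  have h2 : ∀ᵐ ω ∂P, ω ∈ {ω | attackMeasure t ω {0} = (0 : ℕ)} :=
    (mem_ae_iff_prob_eq_one (hm (measurableSet_singleton _))).2 h1
  filter_upwards [h2] with ω hω k hk
  have hω : attackMeasure t ω {0} = (0 : ℕ) := hω
  rw [attackMeasure_apply hB, Nat.cast_zero, ENNReal.tsum_eq_zero] at hω
  simpa [hk] using hω k

theorem IsPoissonPointProcess.ae_isRegularPath_const (ht : IsPoissonPointProcess P lam t)
    {σ : ℕ → ℝ} (h0 : σ 0 = 0) (hσ : ∀ i, σ i < σ (i + 1)) :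
    ∀ᵐ ω ∂P, IsRegularPath t (fun i _ => σ i) ω := by
  filter_upwards [ht.ae_finite, ht.ae_ne_zero] with ω h1 h2
  refine ⟨h0, hσ, fun i => ?_, h2⟩
  have hm : Monotone σ := (strictMono_nat_of_lt_succ hσ).monotone
  obtain ⟨N, hN⟩ := exists_nat_ge (σ i)
  refine (h1 N).subset fun k hk => ?_
  cases i with
  | zero => exact ⟨hk.1, hk.2.trans hN⟩
  | succ i =>
    refine ⟨?_, hk.2.trans hN⟩
    have := hm (Nat.zero_le i)
    have hk1 : σ i < t k ω := hk.1
    linarith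

/-- For deterministic epochs the attack counts of the windows are independent Poisson variables. -/
theorem IsPoissonPointProcess.measureReal_attackCount (ht : IsPoissonPointProcess P lam t)
    (hlam : 0 < lam) {σ : ℕ → ℝ} (h0 : σ 0 = 0) (hσ : ∀ i, σ i < σ (i + 1)) (s : Finset ℕ)
    (k : ℕ → ℕ) :
    P.real {ω | ∀ i ∈ s, attackCount t (fun i _ => σ i) i ω = k i}
      = ∏ i ∈ s, Real.exp (-(lam * (σ (i + 1) - σ i))) * (lam * (σ (i + 1) - σ i)) ^ k i
          / (k i).factorial := by
  have hm : Monotone σ := (strictMono_nat_of_lt_succ hσ).monotone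
  let e := s.equivFin.symm
  have h1 := ht.law s.card (fun j => Set.Ioc (σ (e j)) (σ (e j + 1))) (fun _ => measurableSet_Ioc)
    (fun j x hx => by
      have := hm (Nat.zero_le (e j))
      have hx1 := hx.1
      simp only [Set.mem_Ici]
      linarith) (fun j => by simp)
    (fun i j hij => window_disjoint (τ := fun i (_ : Unit) => σ i) (ω := ()) hσ
      (fun h => hij (e.injective (Subtype.ext h))))
    (fun j => k (e j))
  have h2 : P {ω | ∀ i ∈ s, attackCount t (fun i _ => σ i) i ω = k i}
      = P {ω | ∀ j, attackMeasure t ω (Set.Ioc (σ (e j)) (σ (e j + 1))) = (k (e j) : ENNReal)} := by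
    refine measure_congr ?_
    filter_upwards [ht.ae_isRegularPath_const h0 hσ] with ω hω
    have h3 : ∀ i, attackMeasure t ω (Set.Ioc (σ i) (σ (i + 1)))
        = (attackCount t (fun i _ => σ i) i ω : ENNReal) := by
      intro i
      rw [hω.attackCount_eq]
      exact attackMeasure_eq_card measurableSet_Ioc (hω.finite (i + 1))
    refine propext ?_
    change (∀ i ∈ s, _) ↔ ∀ j, _
    simp only [h3, Nat.cast_inj]
    constructor
    · exact fun h j => h _ (e j).2
    · intro h i hi
      simpa using h (e.symm ⟨i, hi⟩)
  rw [measureReal_def, h2, h1, ENNReal.toReal_prod]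
  rw [← Finset.prod_coe_sort s, ← e.prod_comp]
  refine Finset.prod_congr rfl fun j _ => ?_
  have hnn : 0 ≤ σ (e j + 1) - σ (e j) := sub_nonneg.2 (hσ _).le
  rw [← measureReal_def, poissonMeasure_real_singleton]
  simp [Real.volume_Ioc, hlam.le, ENNReal.coe_toNNReal_eq_toReal, ENNReal.toReal_ofReal hnn]

end

/-! ### Independence of the windows -/

/-- `iIndepFun_pair_of_measure_inter` with the probabilities written as integrals of indicators of
the first coordinates over events about the second ones. -/
theorem iIndepFun_pair_of_setIntegral [MeasurableSpace Ω] {P : Measure Ω} [IsFiniteMeasure P]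
    {ι : Type*} {X : ι → Ω → ℝ} {K : ι → Ω → ℕ} (hX : ∀ i, Measurable (X i))
    (hK : ∀ i, Measurable (K i))
    (hind : ∀ (s : Finset ι) (B : ι → Set ℝ) (k : ι → ℕ), (∀ i, MeasurableSet (B i)) →
      ∫ ω in {ω | ∀ i ∈ s, K i ω = k i}, ∏ i ∈ s, (B i).indicator (1 : ℝ → ℂ) (X i ω) ∂P
        = ∏ i ∈ s, ∫ ω in {ω | K i ω = k i}, (B i).indicator (1 : ℝ → ℂ) (X i ω) ∂P) :
    iIndepFun (fun i ω => (X i ω, K i ω)) P := by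
  have key : ∀ (s : Finset ι) (B : ι → Set ℝ) (k : ι → ℕ), (∀ i, MeasurableSet (B i)) →
      ∫ ω in {ω | ∀ i ∈ s, K i ω = k i}, ∏ i ∈ s, (B i).indicator (1 : ℝ → ℂ) (X i ω) ∂P
        = (P.real {ω | ∀ i ∈ s, X i ω ∈ B i ∧ K i ω = k i} : ℂ) := by
    intro s B k hB
    have hS : MeasurableSet {ω | ∀ i ∈ s, X i ω ∈ B i} := by
      simp only [Set.ofPred_forall]
      exact Finset.measurableSet_biInter s fun i _ => hX i (hB i)
    have h1 : ∀ ω, ∏ i ∈ s, (B i).indicator (1 : ℝ → ℂ) (X i ω)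
        = {ω | ∀ i ∈ s, X i ω ∈ B i}.indicator 1 ω := by
      intro ω
      by_cases h : ∀ i ∈ s, X i ω ∈ B i
      · rw [Set.indicator_of_mem (by exact h)]
        exact Finset.prod_eq_one fun i hi => by simp [h i hi]
      · rw [Set.indicator_of_notMem (by exact h)]
        push Not at h
        obtain ⟨i, hi, hiB⟩ := h
        exact Finset.prod_eq_zero hi (by simp [hiB])
    simp only [h1]
    rw [integral_indicator hS]
    simp only [Pi.one_apply, integral_const, measureReal_restrict_apply_univ]
    rw [measureReal_restrict_apply hS, Complex.real_smul, mul_one]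
    congr 2
    ext ω
    simp only [Set.mem_inter_iff, Set.mem_ofPred_eq]
    exact ⟨fun h i hi => ⟨h.1 i hi, h.2 i hi⟩,
      fun h => ⟨fun i hi => (h i hi).1, fun i hi => (h i hi).2⟩⟩
  refine iIndepFun_pair_of_measure_inter hX hK fun s B k hB => ?_
  have h1 := hind s B k hB
  rw [key s B k hB] at h1
  have h2 : ∀ i, ∫ ω in {ω | K i ω = k i}, (B i).indicator (1 : ℝ → ℂ) (X i ω) ∂P
      = (P.real {ω | X i ω ∈ B i ∧ K i ω = k i} : ℂ) := fun i => by
    simpa using key {i} B k hB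
  simp only [h2] at h1
  have h3 : P.real {ω | ∀ i ∈ s, X i ω ∈ B i ∧ K i ω = k i}
      = ∏ i ∈ s, P.real {ω | X i ω ∈ B i ∧ K i ω = k i} := by exact_mod_cast h1
  simp only [measureReal_def] at h3
  rw [← ENNReal.toReal_prod] at h3
  exact (ENNReal.toReal_eq_toReal_iff' (measure_ne_top _ _)
    (ENNReal.prod_ne_top fun i _ => measure_ne_top _ _)).1 h3

theorem iIndepFun.integral_finset_prod_comp [MeasurableSpace Ω] {P : Measure Ω} {ι β : Type*}
    [MeasurableSpace β] {X : ι → Ω → β} (hX : iIndepFun X P) (hm : ∀ i, Measurable (X i))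
    (s : Finset ι) {f : ι → β → ℂ} (hf : ∀ i, Measurable (f i)) :
    ∫ ω, ∏ i ∈ s, f i (X i ω) ∂P = ∏ i ∈ s, ∫ ω, f i (X i ω) ∂P := by
  have h := (hX.precomp (g := fun i : ↥s => (i : ι)) Subtype.val_injective).integral_fun_prod_comp
    (X := fun (i : ↥s) => X i) (f := fun i => f i) (fun i => (hm i).aemeasurable)
    (fun i => (hf i).aestronglyMeasurable)
  rw [← Finset.prod_coe_sort s]
  rw [← h]
  refine integral_congr_ae (Filter.Eventually.of_forall fun ω => ?_)
  exact (Finset.prod_coe_sort s fun i => f i (X i ω)).symm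

theorem integrable_of_norm_le [MeasurableSpace Ω] {P : Measure Ω} [IsFiniteMeasure P] (f : Ω → ℂ)
    (hf : Measurable f) (hb : ∀ᵐ ω ∂P, ‖f ω‖ ≤ 1) : Integrable f P :=
  Integrable.of_bound hf.aestronglyMeasurable 1 hb

theorem norm_indicator_one_le (B : Set ℝ) (u : ℝ) : ‖B.indicator (1 : ℝ → ℂ) u‖ ≤ 1 := by
  by_cases h : u ∈ B <;> simp [h]

/-- The gap `τ_{i+1} - τ_i` between consecutive observations. -/
def gap (τ : ℕ → Ω → ℝ) (i : ℕ) (ω : Ω) : ℝ := τ (i + 1) ω - τ i ω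

namespace ExponentialObservationModel
variable [MeasurableSpace Ω] {P : Measure Ω} {lam mu a xi : ℝ}
  {t : ℕ → Ω → ℝ} {n : ℕ → Ω → ℕ} {w : ℕ → ℕ → Ω → ℝ} {τ : ℕ → Ω → ℝ}

theorem measurable_gap (H : ExponentialObservationModel P lam mu a xi t n w τ) (i : ℕ) :
    Measurable (gap τ i) :=
  (H.measurable_observation (i + 1)).sub (H.measurable_observation i)

theorem measurable_times (H : ExponentialObservationModel P lam mu a xi t n w τ) :
    Measurable fun ω k => t k ω := measurable_pi_lambda _ H.attacks.measurable

theorem measurable_batches (H : ExponentialObservationModel P lam mu a xi t n w τ) :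
    Measurable fun ω k => n k ω := measurable_pi_lambda _ H.measurable_nodes

theorem measurable_weights (H : ExponentialObservationModel P lam mu a xi t n w τ) :
    Measurable fun ω k j => w k j ω :=
  measurable_pi_lambda _ fun k => measurable_pi_lambda _ fun j => H.measurable_weight k j

theorem measurable_epochs (H : ExponentialObservationModel P lam mu a xi t n w τ) :
    Measurable fun ω i => τ i ω := measurable_pi_lambda _ H.measurable_observation

theorem indepFun_times_epochs (H : ExponentialObservationModel P lam mu a xi t n w τ) :
    IndepFun (fun ω k => t k ω) (fun ω i => τ i ω) P :=
  H.indep_observation.comp measurable_fst measurable_id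

theorem ae_epochs (H : ExponentialObservationModel P lam mu a xi t n w τ) :
    ∀ᵐ ω ∂P, τ 0 ω = 0 ∧ ∀ i, τ i ω < τ (i + 1) ω := by
  have h : ∀ᵐ ω ∂P, ∀ i, 0 < gap τ i ω :=
    ae_all_iff.2 fun i => ae_pos_of_map_eq_expMeasure (H.measurable_gap i) (H.increment_law i)
  filter_upwards [H.initial_observation, h] with ω h0 h1
  exact ⟨h0, fun i => sub_pos.1 (h1 i)⟩

theorem ae_gap_pos (H : ExponentialObservationModel P lam mu a xi t n w τ) :
    ∀ᵐ ω ∂P, ∀ i, 0 < gap τ i ω := by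
  filter_upwards [H.ae_epochs] with ω hω i using sub_pos.2 (hω.2 i)

variable [IsProbabilityMeasure P]

theorem indepFun_batches (H : ExponentialObservationModel P lam mu a xi t n w τ) :
    IndepFun (fun ω k => n k ω) (fun ω => ((fun k => t k ω), (fun i => τ i ω))) P :=
  indepFun_prodMk_right_of_indepFun H.measurable_batches H.measurable_times H.measurable_epochs
    H.indep_nodes.symm (H.indep_observation.comp
      (φ := fun p => (p.2.1, p.1)) (by fun_prop) measurable_id)

theorem indepFun_weights (H : ExponentialObservationModel P lam mu a xi t n w τ) :
    IndepFun (fun ω k j => w k j ω)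
      (fun ω => (((fun k => t k ω), (fun k => n k ω)), (fun i => τ i ω))) P :=
  indepFun_prodMk_right_of_indepFun H.measurable_weights
    (H.measurable_times.prodMk H.measurable_batches) H.measurable_epochs
    H.indep_weight.symm (H.indep_observation.comp
      (φ := fun p => (p.2.2, (p.1, p.2.1))) (by fun_prop) measurable_id)

theorem ae_isRegularPath (H : ExponentialObservationModel P lam mu a xi t n w τ) :
    ∀ᵐ ω ∂P, IsRegularPath t τ ω := by
  filter_upwards [H.attacks.ae_finite, H.attacks.ae_ne_zero, H.ae_epochs] with ω h1 h2 h3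
  refine ⟨h3.1, h3.2, fun i => ?_, h2⟩
  have hm : Monotone fun i => τ i ω := (strictMono_nat_of_lt_succ h3.2).monotone
  obtain ⟨N, hN⟩ := exists_nat_ge (τ i ω)
  refine (h1 N).subset fun k hk => ?_
  cases i with
  | zero => exact ⟨hk.1, hk.2.trans hN⟩
  | succ i =>
    refine ⟨?_, hk.2.trans hN⟩
    have h4 : τ 0 ω ≤ τ i ω := hm (Nat.zero_le i)
    have hk1 : τ i ω < t k ω := hk.1
    linarith [h3.1]

theorem integrable_prod_gap (H : ExponentialObservationModel P lam mu a xi t n w τ)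
    {g : ℕ → ℝ → ℂ} (hg : ∀ i, Measurable (g i)) (hb : ∀ i u, 0 ≤ u → ‖g i u‖ ≤ 1)
    (s : Finset ℕ) : Integrable (fun ω => ∏ i ∈ s, g i (gap τ i ω)) P := by
  refine Integrable.of_bound (C := 1) (Finset.measurable_fun_prod s fun i _ =>
    (hg i).comp (H.measurable_gap i)).aestronglyMeasurable ?_
  filter_upwards [H.ae_gap_pos] with ω hω
  rw [norm_prod]
  exact Finset.prod_le_one (fun _ _ => norm_nonneg _) fun i _ => hb i _ (hω i).le

/-- Conditioning on the epochs: given them, the attack counts are independent Poisson variables. -/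
theorem setIntegral_attackCount_prod (H : ExponentialObservationModel P lam mu a xi t n w τ)
    (hlam : 0 < lam) {g : ℕ → ℝ → ℂ} (hg : ∀ i, Measurable (g i))
    (hb : ∀ i u, 0 ≤ u → ‖g i u‖ ≤ 1) (s : Finset ℕ) (k : ℕ → ℕ) :
    ∫ ω in {ω | ∀ i ∈ s, attackCount t τ i ω = k i}, ∏ i ∈ s, g i (gap τ i ω) ∂P
      = ∏ i ∈ s, ∫ u, g i u *
        ((Real.exp (-(lam * u)) * (lam * u) ^ k i / (k i).factorial : ℝ) : ℂ) ∂(expMeasure mu) := by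
  let C : Set ((ℕ → ℝ) × (ℕ → ℝ)) := {p | ∀ i ∈ s,
    attackCount (fun k (p : (ℕ → ℝ) × (ℕ → ℝ)) => p.1 k)
      (fun i (p : (ℕ → ℝ) × (ℕ → ℝ)) => p.2 i) i p = k i}
  have hC : MeasurableSet C := by
    simp only [C, Set.ofPred_forall]
    exact Finset.measurableSet_biInter s fun i _ => measurable_attackCount (fun k => by fun_prop)
      (fun i => by fun_prop) i (measurableSet_singleton _)
  have h1 := setIntegral_of_indepFun H.measurable_times H.measurable_epochs
    H.indepFun_times_epochs hC
    (g := fun σ => ∏ i ∈ s, g i (σ (i + 1) - σ i)) (by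
      refine Finset.measurable_fun_prod s fun i _ => (hg i).comp ?_
      fun_prop)
    (H.integrable_prod_gap hg hb s)
    (q := fun σ => ∏ i ∈ s, Real.exp (-(lam * (σ (i + 1) - σ i)))
      * (lam * (σ (i + 1) - σ i)) ^ k i / (k i).factorial) (by
      filter_upwards [H.ae_epochs] with ω hω
      exact H.attacks.measureReal_attackCount hlam hω.1 hω.2 s k)
  refine h1.trans ?_
  have h2 : ∀ i, Measurable fun u : ℝ => g i u *
        ((Real.exp (-(lam * u)) * (lam * u) ^ k i / (k i).factorial : ℝ) : ℂ) := fun i =>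
    (hg i).mul (by fun_prop)
  have h3 := iIndepFun.integral_finset_prod_comp (X := gap τ) H.increment_indep H.measurable_gap s h2
  have h4 : ∀ i, ∫ u, g i u *
        ((Real.exp (-(lam * u)) * (lam * u) ^ k i / (k i).factorial : ℝ) : ℂ) ∂(expMeasure mu)
      = ∫ ω, g i (gap τ i ω) * ((Real.exp (-(lam * gap τ i ω)) * (lam * gap τ i ω) ^ k i
          / (k i).factorial : ℝ) : ℂ) ∂P := fun i => by
    rw [← H.increment_law i]
    exact integral_map (H.measurable_gap i).aemeasurable (h2 i).aestronglyMeasurable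
  rw [Finset.prod_congr rfl fun i _ => h4 i, ← h3]
  refine integral_congr_ae (Filter.Eventually.of_forall fun ω => ?_)
  simp only [Complex.ofReal_prod, ← Finset.prod_mul_distrib]
  rfl

theorem setIntegral_attackCount (H : ExponentialObservationModel P lam mu a xi t n w τ)
    (hlam : 0 < lam) {g : ℝ → ℂ} (hg : Measurable g)
    (hb : ∀ u, 0 ≤ u → ‖g u‖ ≤ 1) (i k : ℕ) :
    ∫ ω in {ω | attackCount t τ i ω = k}, g (gap τ i ω) ∂P
      = ∫ u, g u *
        ((Real.exp (-(lam * u)) * (lam * u) ^ k / k.factorial : ℝ) : ℂ) ∂(expMeasure mu) := by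
  simpa using H.setIntegral_attackCount_prod hlam (g := fun _ => g) (fun _ => hg) (fun _ => hb)
    {i} (fun _ => k)

theorem iIndepFun_gap_attackCount (H : ExponentialObservationModel P lam mu a xi t n w τ)
    (hlam : 0 < lam) : iIndepFun (fun i ω => (gap τ i ω, attackCount t τ i ω)) P := by
  refine iIndepFun_pair_of_setIntegral H.measurable_gap
    (measurable_attackCount H.attacks.measurable H.measurable_observation) fun s B k hB => ?_
  have hg : ∀ i, Measurable ((B i).indicator (1 : ℝ → ℂ)) := fun i => measurable_one.indicator (hB i)
  rw [H.setIntegral_attackCount_prod hlam hg (fun i u _ => norm_indicator_one_le _ u)]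
  exact Finset.prod_congr rfl fun i _ =>
    (H.setIntegral_attackCount hlam (hg i) (fun u _ => norm_indicator_one_le _ u) i (k i)).symm

/-- For the attack times and epochs of a fixed regular path `ω₀`, and random batches, the node
counts of the windows are independent sums of `attackCount` many batches. -/
theorem measureReal_nodeCount (H : ExponentialObservationModel P lam mu a xi t n w τ)
    (ha : 0 < a) (ha' : a ≤ 1) (s : Finset ℕ) (x : ℕ → ℕ) {ω₀ : Ω} (h : IsRegularPath t τ ω₀) :
    P.real {ω | ∀ i ∈ s, nodeCount (fun k _ => t k ω₀) n (fun i _ => τ i ω₀) i ω = x i}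
      = ∏ i ∈ s, PowerSeries.coeff (x i) (batchSeries a ^ attackCount t τ i ω₀) := by
  have h1 : ∀ ω i, nodeCount (fun k _ => t k ω₀) n (fun i _ => τ i ω₀) i ω
      = ∑ k ∈ windowAttacks t τ ω₀ h (i + 1), n k ω := fun ω i =>
    IsRegularPath.nodeCount_eq (t := fun k _ => t k ω₀) (τ := fun i _ => τ i ω₀) (ω := ω)
      ⟨h.zero, h.lt, h.finite, h.ne_zero⟩ i
  simp only [h1]
  rw [measureReal_forall_sum_eq H.measurable_nodes H.nodes_indep s _ h.disjoint]
  refine Finset.prod_congr rfl fun i _ => ?_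
  rw [measureReal_sum_batch_eq H.measurable_nodes H.nodes_indep
    (fun k => measureReal_batch_eq ha ha' (H.measurable_nodes k) (H.nodes_law k)), h.attackCount_eq]

/-- Conditioning on the attack times and the epochs: given them, the node counts are independent,
and their laws depend on the attack counts only. -/
theorem setIntegral_nodeCount_prod (H : ExponentialObservationModel P lam mu a xi t n w τ)
    (hlam : 0 < lam) (ha : 0 < a) (ha' : a ≤ 1) {g : ℕ → ℝ → ℂ} (hg : ∀ i, Measurable (g i))
    (hb : ∀ i u, 0 ≤ u → ‖g i u‖ ≤ 1) (s : Finset ℕ) (x : ℕ → ℕ) :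
    ∫ ω in {ω | ∀ i ∈ s, nodeCount t n τ i ω = x i}, ∏ i ∈ s, g i (gap τ i ω) ∂P
      = ∏ i ∈ s, ∫ ω, g i (gap τ i ω) *
        ((PowerSeries.coeff (x i) (batchSeries a ^ attackCount t τ i ω) : ℝ) : ℂ) ∂P := by
  let C : Set ((ℕ → ℕ) × (ℕ → ℝ) × (ℕ → ℝ)) := {p | ∀ i ∈ s, nodeCount
    (fun k (p : (ℕ → ℕ) × (ℕ → ℝ) × (ℕ → ℝ)) => p.2.1 k)
    (fun k (p : (ℕ → ℕ) × (ℕ → ℝ) × (ℕ → ℝ)) => p.1 k)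
    (fun i (p : (ℕ → ℕ) × (ℕ → ℝ) × (ℕ → ℝ)) => p.2.2 i) i p = x i}
  have hC : MeasurableSet C := by
    simp only [C, Set.ofPred_forall]
    exact Finset.measurableSet_biInter s fun i _ => measurable_nodeCount (fun k => by fun_prop)
      (fun i => by fun_prop) (fun k => by fun_prop) i (measurableSet_singleton _)
  have h1 := setIntegral_of_indepFun H.measurable_batches
    (H.measurable_times.prodMk H.measurable_epochs) H.indepFun_batches hC
    (g := fun σ => ∏ i ∈ s, g i (σ.2 (i + 1) - σ.2 i)) (by
      refine Finset.measurable_fun_prod s fun i _ => (hg i).comp ?_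
      fun_prop)
    (H.integrable_prod_gap hg hb s)
    (q := fun σ => ∏ i ∈ s, PowerSeries.coeff (x i) (batchSeries a ^
      attackCount (fun k (p : (ℕ → ℝ) × (ℕ → ℝ)) => p.1 k)
        (fun i (p : (ℕ → ℝ) × (ℕ → ℝ)) => p.2 i) i σ)) (by
      filter_upwards [H.ae_isRegularPath] with ω hω
      exact H.measureReal_nodeCount ha ha' s x hω)
  refine h1.trans ?_
  have h3 := iIndepFun.integral_finset_prod_comp (H.iIndepFun_gap_attackCount hlam)
    (fun i => (H.measurable_gap i).prodMk
      (measurable_attackCount H.attacks.measurable H.measurable_observation i)) s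
    (f := fun i p => g i p.1 * ((PowerSeries.coeff (x i) (batchSeries a ^ p.2) : ℝ) : ℂ))
    (fun i => ((hg i).comp measurable_fst).mul (Complex.measurable_ofReal.comp
      ((measurable_from_top (f := fun k : ℕ => PowerSeries.coeff (x i) (batchSeries a ^ k))).comp
        measurable_snd)))
  rw [← h3]
  refine integral_congr_ae (Filter.Eventually.of_forall fun ω => ?_)
  simp only [Complex.ofReal_prod, ← Finset.prod_mul_distrib]
  rfl

/-- The embedded walk: the pairs of a gap and the number of nodes lost during it are
independent. -/
theorem iIndepFun_gap_nodeCount (H : ExponentialObservationModel P lam mu a xi t n w τ)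
    (hlam : 0 < lam) (ha : 0 < a) (ha' : a ≤ 1) :
    iIndepFun (fun i ω => (gap τ i ω, nodeCount t n τ i ω)) P := by
  refine iIndepFun_pair_of_setIntegral H.measurable_gap (measurable_nodeCount H.attacks.measurable
    H.measurable_observation H.measurable_nodes) fun s B k hB => ?_
  have hg : ∀ i, Measurable ((B i).indicator (1 : ℝ → ℂ)) := fun i => measurable_one.indicator (hB i)
  have hb : ∀ i u, 0 ≤ u → ‖(B i).indicator (1 : ℝ → ℂ) u‖ ≤ 1 :=
    fun i u _ => norm_indicator_one_le _ u
  rw [H.setIntegral_nodeCount_prod hlam ha ha' hg hb]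
  refine Finset.prod_congr rfl fun i _ => ?_
  simpa using (H.setIntegral_nodeCount_prod hlam ha ha' hg hb {i} k).symm

theorem setIntegral_nodeCount_exp (H : ExponentialObservationModel P lam mu a xi t n w τ)
    (hlam : 0 < lam) (hmu : 0 < mu) (ha : 0 < a) (ha' : a ≤ 1) {h : ℂ} (hh : 0 ≤ h.re) (i x : ℕ) :
    ∫ ω in {ω | nodeCount t n τ i ω = x}, Complex.exp (-h * gap τ i ω) ∂P
      = windowCoeff lam mu a h x := by
  have hg : Measurable fun u : ℝ => Complex.exp (-h * u) := by fun_prop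
  have hb : ∀ u : ℝ, 0 ≤ u → ‖Complex.exp (-h * u)‖ ≤ 1 := by
    intro u hu
    rw [Complex.norm_exp]
    simpa using mul_nonneg hh hu
  have h1 := H.setIntegral_nodeCount_prod hlam ha ha' (g := fun _ u => Complex.exp (-h * u))
    (fun _ => hg) (fun _ => hb) {i} (fun _ => x)
  simp only [Finset.mem_singleton, forall_eq, Finset.prod_singleton] at h1
  have hmA : ∀ k, MeasurableSet {ω | attackCount t τ i ω = k} := fun k =>
    measurable_attackCount H.attacks.measurable H.measurable_observation i (measurableSet_singleton k)
  have hint : Integrable (fun ω => Complex.exp (-h * gap τ i ω)) P := by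
    simpa using H.integrable_prod_gap (g := fun _ u => Complex.exp (-h * u))
      (fun _ => hg) (fun _ => hb) {i}
  have h2 : ∀ ω, Complex.exp (-h * gap τ i ω) *
      ((PowerSeries.coeff x (batchSeries a ^ attackCount t τ i ω) : ℝ) : ℂ)
      = ∑ k ∈ Finset.range (x + 1), {ω | attackCount t τ i ω = k}.indicator
          (fun ω => Complex.exp (-h * gap τ i ω) *
            ((PowerSeries.coeff x (batchSeries a ^ k) : ℝ) : ℂ)) ω := by
    intro ω
    by_cases hk : attackCount t τ i ω < x + 1
    · rw [Finset.sum_eq_single (attackCount t τ i ω)]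
      · simp
      · intro k _ hne
        simp [hne.symm]
      · exact fun h => absurd (Finset.mem_range.2 hk) h
    · rw [coeff_batchSeries_pow_of_lt a (by omega), Finset.sum_eq_zero]
      · simp
      · intro k hk'
        rw [Finset.mem_range] at hk'
        exact Set.indicator_of_notMem (fun h => by
          have h : attackCount t τ i ω = k := h
          omega) _
  rw [h1, integral_congr_ae (Filter.Eventually.of_forall h2), integral_finsetSum]
  · rw [windowCoeff]
    refine Finset.sum_congr rfl fun k _ => ?_
    rw [integral_indicator (hmA k), integral_mul_const, H.setIntegral_attackCount hlam hg hb,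
      integral_exp_mul_poisson k hlam hmu hh]
  · exact fun k _ => (hint.mul_const _).indicator (hmA k)

end ExponentialObservationModel

/-! ### Expected discounts of the embedded walk -/

/-- The number of nodes lost in the first `l` windows, for a sequence of pairs of a gap and a node
count. -/
def totalNodes (ζ : ℕ → ℝ × ℕ) (l : ℕ) : ℕ := ∑ i ∈ Finset.range l, (ζ i).2

/-- The discount factor accumulated over the first `l` windows: a window is discounted at rate `h`
when more than `M₁` nodes are lost at its left end, and not at all otherwise. -/
def discount (M₁ : ℕ) (h : ℂ) (ζ : ℕ → ℝ × ℕ) (l : ℕ) : ℂ :=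
  ∏ i ∈ Finset.range l, Complex.exp (-(if M₁ < totalNodes ζ i then h else 0) * (ζ i).1)

@[fun_prop]
theorem measurable_totalNodes (l : ℕ) : Measurable fun ζ => totalNodes ζ l := by
  unfold totalNodes; fun_prop

@[fun_prop]
theorem measurable_discount (M₁ : ℕ) (h : ℂ) (l : ℕ) : Measurable fun ζ => discount M₁ h ζ l := by
  unfold discount
  refine Finset.measurable_fun_prod _ fun i _ => Complex.measurable_exp.comp ?_
  refine Measurable.mul (Measurable.neg ?_) (by fun_prop)
  exact Measurable.ite (measurableSet_lt measurable_const (measurable_totalNodes i))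
    measurable_const measurable_const

theorem totalNodes_congr {ζ ζ' : ℕ → ℝ × ℕ} {l : ℕ} (h : ∀ i < l, ζ i = ζ' i) :
    totalNodes ζ l = totalNodes ζ' l :=
  Finset.sum_congr rfl fun i hi => by rw [h i (Finset.mem_range.1 hi)]

theorem discount_congr {M₁ : ℕ} {h : ℂ} {ζ ζ' : ℕ → ℝ × ℕ} {l : ℕ} (hζ : ∀ i < l, ζ i = ζ' i) :
    discount M₁ h ζ l = discount M₁ h ζ' l := by
  refine Finset.prod_congr rfl fun i hi => ?_
  rw [Finset.mem_range] at hi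
  rw [hζ i hi, totalNodes_congr fun j hj => hζ j (hj.trans hi)]

theorem totalNodes_mono (ζ : ℕ → ℝ × ℕ) : Monotone (totalNodes ζ) := fun _ _ h =>
  Finset.sum_le_sum_of_subset (Finset.range_mono h)

theorem norm_discount_le {M₁ : ℕ} {h : ℂ} (hh : 0 ≤ h.re) {ζ : ℕ → ℝ × ℕ}
    (hζ : ∀ i, 0 ≤ (ζ i).1) (l : ℕ) : ‖discount M₁ h ζ l‖ ≤ 1 := by
  rw [discount, norm_prod]
  refine Finset.prod_le_one (fun _ _ => norm_nonneg _) fun i _ => ?_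
  rw [Complex.norm_exp]
  split_ifs
  · simpa using mul_nonneg hh (hζ i)
  · simp

/-- The sequence of pairs of a gap and the number of nodes lost during it. -/
def windowData (t : ℕ → Ω → ℝ) (n : ℕ → Ω → ℕ) (τ : ℕ → Ω → ℝ) (ω : Ω) (i : ℕ) : ℝ × ℕ :=
  (gap τ i ω, nodeCount t n τ i ω)

/-- A recursive comparison with a geometric sequence. -/
theorem summable_of_succ_le {u v : ℕ → ℝ} {r : ℝ} (hu : ∀ l, 0 ≤ u l) (hv : ∀ l, 0 ≤ v l)
    (hr : r < 1) (hvs : Summable v) (h : ∀ l, u (l + 1) ≤ r * u l + v l) : Summable u := by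
  refine summable_of_sum_range_le hu (c := (u 0 + ∑' l, v l) / (1 - r)) fun L => ?_
  rw [le_div_iff₀ (sub_pos.2 hr)]
  have h1 : ∑ l ∈ Finset.range L, u l ≤ ∑ l ∈ Finset.range (L + 1), u l := by
    rw [Finset.sum_range_succ]; linarith [hu L]
  rw [Finset.sum_range_succ'] at h1
  have h2 : ∑ l ∈ Finset.range L, u (l + 1)
      ≤ r * ∑ l ∈ Finset.range L, u l + ∑ l ∈ Finset.range L, v l := by
    rw [Finset.mul_sum, ← Finset.sum_add_distrib]
    exact Finset.sum_le_sum fun l _ => h l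
  have h3 := hvs.sum_le_tsum (Finset.range L) fun l _ => hv l
  linarith

namespace ExponentialObservationModel
variable [MeasurableSpace Ω] {P : Measure Ω} {lam mu a xi : ℝ}
  {t : ℕ → Ω → ℝ} {n : ℕ → Ω → ℕ} {w : ℕ → ℕ → Ω → ℝ} {τ : ℕ → Ω → ℝ}

theorem measurable_windowData_apply (H : ExponentialObservationModel P lam mu a xi t n w τ)
    (i : ℕ) : Measurable fun ω => windowData t n τ ω i :=
  (H.measurable_gap i).prodMk (measurable_nodeCount H.attacks.measurable
    H.measurable_observation H.measurable_nodes i)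

theorem measurable_windowData (H : ExponentialObservationModel P lam mu a xi t n w τ) :
    Measurable (windowData t n τ) := measurable_pi_lambda _ H.measurable_windowData_apply

/-- The expected discount `E[discount; N_l = m]` over the first `l` windows. -/
def expectedDiscount (P : Measure Ω) (t : ℕ → Ω → ℝ) (n : ℕ → Ω → ℕ) (τ : ℕ → Ω → ℝ) (M₁ : ℕ)
    (h : ℂ) (l m : ℕ) : ℂ :=
  ∫ ω in {ω | totalNodes (windowData t n τ ω) l = m}, discount M₁ h (windowData t n τ ω) l ∂P

theorem measurableSet_totalNodes (H : ExponentialObservationModel P lam mu a xi t n w τ)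
    (l m : ℕ) : MeasurableSet {ω | totalNodes (windowData t n τ ω) l = m} :=
  ((measurable_totalNodes l).comp H.measurable_windowData) (measurableSet_singleton m)

theorem ae_norm_discount_le (H : ExponentialObservationModel P lam mu a xi t n w τ)
    (M₁ : ℕ) {h : ℂ} (hh : 0 ≤ h.re) :
    ∀ᵐ ω ∂P, ∀ l, ‖discount M₁ h (windowData t n τ ω) l‖ ≤ 1 := by
  filter_upwards [H.ae_gap_pos] with ω hω l
  exact norm_discount_le hh (fun i => (hω i).le) l

theorem ae_norm_exp_gap_le (H : ExponentialObservationModel P lam mu a xi t n w τ)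
    {h : ℂ} (hh : 0 ≤ h.re) : ∀ᵐ ω ∂P, ∀ l, ‖Complex.exp (-h * gap τ l ω)‖ ≤ 1 := by
  filter_upwards [H.ae_gap_pos] with ω hω l
  rw [Complex.norm_exp]
  simpa using mul_nonneg hh (hω l).le

variable [IsProbabilityMeasure P]

/-- The `l`-th window is independent of the past. -/
theorem integral_discount_mul (H : ExponentialObservationModel P lam mu a xi t n w τ)
    (hlam : 0 < lam) (ha : 0 < a) (ha' : a ≤ 1) (M₁ : ℕ) (h : ℂ) (l m : ℕ) {F : ℝ × ℕ → ℂ}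
    (hF : Measurable F) :
    ∫ ω in {ω | totalNodes (windowData t n τ ω) l = m},
      discount M₁ h (windowData t n τ ω) l * F (windowData t n τ ω l) ∂P
      = expectedDiscount P t n τ M₁ h l m * ∫ ω, F (windowData t n τ ω l) ∂P := by
  have hS := H.measurableSet_totalNodes l m
  have hS' : MeasurableSet {ζ : ℕ → ℝ × ℕ | totalNodes ζ l = m} :=
    measurable_totalNodes l (measurableSet_singleton m)
  let D : (ℕ → ℝ × ℕ) → ℂ := {ζ | totalNodes ζ l = m}.indicator fun ζ => discount M₁ h ζ l
  have hD : Measurable D := (measurable_discount M₁ h l).indicator hS'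
  have hind := indepFun_of_dependsOn_lt (Z := fun i ω => windowData t n τ ω i) (l := l) (F := D)
    H.measurable_windowData_apply (H.iIndepFun_gap_nodeCount hlam ha ha') hD (by
      intro ζ ζ' hζ
      simp only [D, Set.indicator_apply, Set.mem_ofPred_eq, totalNodes_congr hζ,
        discount_congr hζ])
  have h1 := IndepFun.integral_fun_mul_eq_mul_integral (hind.comp measurable_id hF)
    (hD.comp H.measurable_windowData).aestronglyMeasurable
    (hF.comp (H.measurable_windowData_apply l)).aestronglyMeasurable
  have e1 : ∀ ω, D (windowData t n τ ω) * F (windowData t n τ ω l)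
      = {ω | totalNodes (windowData t n τ ω) l = m}.indicator
        (fun ω => discount M₁ h (windowData t n τ ω) l * F (windowData t n τ ω l)) ω := by
    intro ω
    by_cases hω : totalNodes (windowData t n τ ω) l = m <;> simp [D, hω]
  have e2 : ∀ ω, D (windowData t n τ ω) = {ω | totalNodes (windowData t n τ ω) l = m}.indicator
        (fun ω => discount M₁ h (windowData t n τ ω) l) ω := by
    intro ω
    by_cases hω : totalNodes (windowData t n τ ω) l = m <;> simp [D, hω]
  rw [← integral_indicator hS, expectedDiscount, ← integral_indicator hS,
    ← integral_congr_ae (Filter.Eventually.of_forall e1),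
    ← integral_congr_ae (Filter.Eventually.of_forall e2)]
  exact h1

theorem setIntegral_discount_mul_exp (H : ExponentialObservationModel P lam mu a xi t n w τ)
    (hlam : 0 < lam) (hmu : 0 < mu) (ha : 0 < a) (ha' : a ≤ 1) (M₁ : ℕ) (h : ℂ) {h' : ℂ}
    (hh' : 0 ≤ h'.re) (l m : ℕ) :
    ∫ ω in {ω | totalNodes (windowData t n τ ω) l = m},
      discount M₁ h (windowData t n τ ω) l * Complex.exp (-h' * gap τ l ω) ∂P
      = expectedDiscount P t n τ M₁ h l m * (mu / (mu + h')) := by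
  have h1 := H.integral_discount_mul hlam ha ha' M₁ h l m
    (F := fun z => Complex.exp (-h' * z.1)) (by fun_prop)
  refine h1.trans ?_
  congr 1
  rw [← integral_cexp_expMeasure hmu hh', ← H.increment_law l]
  have hm : Measurable fun u : ℝ => Complex.exp (-h' * u) := by fun_prop
  exact (integral_map (H.measurable_gap l).aemeasurable hm.aestronglyMeasurable).symm

theorem setIntegral_discount_mul_exp_nodeCount
    (H : ExponentialObservationModel P lam mu a xi t n w τ)
    (hlam : 0 < lam) (hmu : 0 < mu) (ha : 0 < a) (ha' : a ≤ 1) (M₁ : ℕ) (h : ℂ) {h' : ℂ}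
    (hh' : 0 ≤ h'.re) (l m x : ℕ) :
    ∫ ω in {ω | totalNodes (windowData t n τ ω) l = m ∧ nodeCount t n τ l ω = x},
      discount M₁ h (windowData t n τ ω) l * Complex.exp (-h' * gap τ l ω) ∂P
      = expectedDiscount P t n τ M₁ h l m * windowCoeff lam mu a h' x := by
  have hx : MeasurableSet {z : ℝ × ℕ | z.2 = x} := measurable_snd (measurableSet_singleton x)
  have hx' : MeasurableSet {ω | nodeCount t n τ l ω = x} := H.measurable_windowData_apply l hx
  have h1 := H.integral_discount_mul hlam ha ha' M₁ h l m
    (F := {z : ℝ × ℕ | z.2 = x}.indicator fun z => Complex.exp (-h' * z.1))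
    ((by fun_prop : Measurable fun z : ℝ × ℕ => Complex.exp (-h' * z.1)).indicator hx)
  have e1 : ∀ ω, discount M₁ h (windowData t n τ ω) l * {z : ℝ × ℕ | z.2 = x}.indicator
      (fun z => Complex.exp (-h' * z.1)) (windowData t n τ ω l)
      = {ω | nodeCount t n τ l ω = x}.indicator (fun ω => discount M₁ h (windowData t n τ ω) l *
        Complex.exp (-h' * gap τ l ω)) ω := by
    intro ω
    by_cases hω : nodeCount t n τ l ω = x <;> simp [windowData, hω]
  have e2 : ∀ ω, {z : ℝ × ℕ | z.2 = x}.indicator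
      (fun z => Complex.exp (-h' * z.1)) (windowData t n τ ω l)
      = {ω | nodeCount t n τ l ω = x}.indicator (fun ω => Complex.exp (-h' * gap τ l ω)) ω := by
    intro ω
    by_cases hω : nodeCount t n τ l ω = x <;> simp [windowData, hω]
  simp only [e1] at h1
  simp only [e2] at h1
  rw [setIntegral_indicator hx', integral_indicator hx',
    H.setIntegral_nodeCount_exp hlam hmu ha ha' hh'] at h1
  exact h1

theorem expectedDiscount_zero (t : ℕ → Ω → ℝ) (n : ℕ → Ω → ℕ) (τ : ℕ → Ω → ℝ) (M₁ : ℕ)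
    (h : ℂ) (m : ℕ) : expectedDiscount P t n τ M₁ h 0 m = if m = 0 then 1 else 0 := by
  by_cases hm : m = 0
  · simp [expectedDiscount, totalNodes, discount, hm]
  · have : ¬ (0 = m) := fun h => hm h.symm
    simp [expectedDiscount, totalNodes, hm, this]

theorem expectedDiscount_succ (H : ExponentialObservationModel P lam mu a xi t n w τ)
    (hlam : 0 < lam) (hmu : 0 < mu) (ha : 0 < a) (ha' : a ≤ 1) (M₁ : ℕ) {h : ℂ}
    (hh : 0 ≤ h.re) (l m : ℕ) :
    expectedDiscount P t n τ M₁ h (l + 1) m = ∑ p ∈ Finset.range (m + 1),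
      expectedDiscount P t n τ M₁ h l p
        * windowCoeff lam mu a (if M₁ < p then h else 0) (m - p) := by
  have hU : {ω | totalNodes (windowData t n τ ω) (l + 1) = m} = ⋃ p ∈ Finset.range (m + 1),
      {ω | totalNodes (windowData t n τ ω) l = p ∧ nodeCount t n τ l ω = m - p} := by
    ext ω
    simp only [Set.mem_ofPred_eq, Set.mem_iUnion, Finset.mem_range, exists_prop, totalNodes,
      Finset.sum_range_succ]
    have : (windowData t n τ ω l).2 = nodeCount t n τ l ω := rfl
    rw [this]
    constructor
    · intro h; exact ⟨_, by omega, rfl, by omega⟩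
    · rintro ⟨p, hp, h1, h2⟩; omega
  have hm : ∀ p, MeasurableSet
      {ω | totalNodes (windowData t n τ ω) l = p ∧ nodeCount t n τ l ω = m - p} := fun p =>
    (H.measurableSet_totalNodes l p).inter (measurable_nodeCount H.attacks.measurable
      H.measurable_observation H.measurable_nodes l (measurableSet_singleton _))
  rw [expectedDiscount, hU, integral_biUnion_finset _ (fun p _ => hm p)]
  · refine Finset.sum_congr rfl fun p _ => ?_
    have hp : 0 ≤ (if M₁ < p then h else 0).re := by split_ifs <;> simp [hh]
    rw [← H.setIntegral_discount_mul_exp_nodeCount hlam hmu ha ha' M₁ h hp]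
    refine setIntegral_congr_fun (hm p) fun ω hω => ?_
    have hω1 : totalNodes (windowData t n τ ω) l = p := hω.1
    simp only [discount, Finset.prod_range_succ, hω1]
    rfl
  · intro p _ p' _ hne
    exact Set.disjoint_left.2 fun ω h1 h2 => hne (h1.1.symm.trans h2.1)
  · exact fun p _ => (integrable_of_norm_le _ ((measurable_discount M₁ h (l + 1)).comp
      H.measurable_windowData) ((H.ae_norm_discount_le M₁ hh).mono fun ω hω => hω _)).integrableOn

/-- Only windows without losses keep the walk at `m`, and for them the transform is
`mu / (mu + lam + h)`, of modulus less than one. -/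
theorem summable_norm_expectedDiscount (H : ExponentialObservationModel P lam mu a xi t n w τ)
    (hlam : 0 < lam) (hmu : 0 < mu) (ha : 0 < a) (ha' : a ≤ 1) (M₁ : ℕ) {h : ℂ}
    (hh : 0 ≤ h.re) (m : ℕ) : Summable fun l => ‖expectedDiscount P t n τ M₁ h l m‖ := by
  induction m using Nat.strong_induction_on with
  | _ m ih =>
    set hm : ℂ := if M₁ < m then h else 0 with hhm
    have hre : 0 ≤ hm.re := by rw [hhm]; split_ifs <;> simp [hh]
    refine summable_of_succ_le (r := ‖windowCoeff lam mu a hm 0‖)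
      (v := fun l => ∑ p ∈ Finset.range m, ‖expectedDiscount P t n τ M₁ h l p‖
        * ‖windowCoeff lam mu a (if M₁ < p then h else 0) (m - p)‖)
      (fun l => norm_nonneg _) (fun l => Finset.sum_nonneg fun p _ => by positivity) ?_ ?_ ?_
    · rw [windowCoeff_zero, norm_div, div_lt_one (norm_pos_iff.2 (lam_add_mu_add_ne hlam hmu hre))]
      calc ‖(mu : ℂ)‖ = mu := by simp [abs_of_pos hmu]
        _ < (mu + lam + hm : ℂ).re := by simp; linarith
        _ ≤ _ := Complex.re_le_norm _
    · exact summable_sum fun p hp => (ih p (Finset.mem_range.1 hp)).mul_right _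
    · intro l
      rw [H.expectedDiscount_succ hlam hmu ha ha' M₁ hh, Finset.sum_range_succ, Nat.sub_self,
        add_comm]
      refine (norm_add_le _ _).trans (add_le_add (by rw [norm_mul, mul_comm]) ?_)
      exact (norm_sum_le _ _).trans (Finset.sum_le_sum fun p _ => (norm_mul _ _).le)

/-- The discounted renewal equation for the number of nodes seen by the observations. -/
theorem tsum_expectedDiscount_eq (H : ExponentialObservationModel P lam mu a xi t n w τ)
    (hlam : 0 < lam) (hmu : 0 < mu) (ha : 0 < a) (ha' : a ≤ 1) (M₁ : ℕ) {h : ℂ}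
    (hh : 0 ≤ h.re) (m : ℕ) :
    ∑' l, expectedDiscount P t n τ M₁ h l m = (if m = 0 then 1 else 0)
      + ∑ p ∈ Finset.range (m + 1), (∑' l, expectedDiscount P t n τ M₁ h l p)
        * windowCoeff lam mu a (if M₁ < p then h else 0) (m - p) := by
  have hs := fun m => (H.summable_norm_expectedDiscount hlam hmu ha ha' M₁ hh m).of_norm
  rw [(hs m).tsum_eq_zero_add, expectedDiscount_zero]
  congr 1
  simp only [H.expectedDiscount_succ hlam hmu ha ha' M₁ hh]
  rw [Summable.tsum_finsetSum fun p _ => (hs p).mul_right _]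
  exact Finset.sum_congr rfl fun p _ => tsum_mul_right

theorem summable_measureReal_totalNodes_le
    (H : ExponentialObservationModel P lam mu a xi t n w τ)
    (hlam : 0 < lam) (hmu : 0 < mu) (ha : 0 < a) (ha' : a ≤ 1) (M : ℕ) :
    Summable fun l => P.real {ω | totalNodes (windowData t n τ ω) l ≤ M} := by
  have h1 : ∀ l m, ‖expectedDiscount P t n τ 0 0 l m‖
      = P.real {ω | totalNodes (windowData t n τ ω) l = m} := by
    intro l m
    have : ∀ ζ, discount 0 0 ζ l = 1 := fun ζ => by simp [discount]
    simp [expectedDiscount, this]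
  have h2 : ∀ l, P.real {ω | totalNodes (windowData t n τ ω) l ≤ M}
      = ∑ m ∈ Finset.range (M + 1), P.real {ω | totalNodes (windowData t n τ ω) l = m} := by
    intro l
    rw [← measureReal_biUnion_finset]
    · congr 1
      ext ω
      simp
    · intro p _ p' _ hne
      exact Set.disjoint_left.2 fun ω h1 h2 => hne (Eq.trans (Eq.symm h1) h2)
    · exact fun m _ => H.measurableSet_totalNodes l m
  simp only [h2, ← h1]
  exact summable_sum fun m _ => H.summable_norm_expectedDiscount hlam hmu ha ha' 0 le_rfl m

end ExponentialObservationModel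

/-! ### Conditioning on the weights -/

section
variable {t : ℕ → Ω → ℝ} {n : ℕ → Ω → ℕ} {w : ℕ → ℕ → Ω → ℝ} {τ : ℕ → Ω → ℝ} {ω : Ω}

theorem IsRegularPath.observedNodes_eq (h : IsRegularPath t τ ω) (l : ℕ) :
    observedNodes t n τ l ω = (totalNodes (windowData t n τ ω) l : ENNReal) := by
  rw [observedNodes, Finset.sum_range_succ', h.nodeMeasure_eq, h.windowAttacks_zero]
  simp only [Finset.sum_empty, Nat.cast_zero, add_zero, totalNodes, Nat.cast_sum]
  refine Finset.sum_congr rfl fun i _ => ?_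
  rw [h.nodeMeasure_eq]
  simp [windowData, h.nodeCount_eq]

/-- On a regular path the observed weight is a finite sum of node weights, over a set `E` of nodes
that depends on the attack times, batch sizes and epochs only. -/
theorem IsRegularPath.observedWeight_eq (h : IsRegularPath t τ ω) (hw : ∀ k j, 0 ≤ w k j ω)
    (l : ℕ) : ∃ E : Finset (Σ _ : ℕ, ℕ), E.card = totalNodes (windowData t n τ ω) l ∧
      E = ((Finset.range l).biUnion fun i => windowAttacks t τ ω h (i + 1)).sigma
        (fun k => Finset.range (n k ω)) ∧
      observedWeight t n w τ l ω = ENNReal.ofReal (∑ p ∈ E, w p.1 p.2 ω) := by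
  refine ⟨_, ?_, rfl, ?_⟩
  · rw [Finset.card_sigma, Finset.sum_biUnion fun i _ j _ hij => h.disjoint hij]
    simp only [Finset.card_range, totalNodes]
    exact Finset.sum_congr rfl fun i _ => (h.nodeCount_eq i).symm
  · have h0 : ∀ i, weightMeasure t n w ω (window τ ω i) = ∑ k ∈ windowAttacks t τ ω h i,
        ENNReal.ofReal (∑ j ∈ Finset.range (n k ω), w k j ω) := fun i =>
      weightMeasure_eq_sum (measurableSet_window _ _ _) (h.finite i)
    rw [observedWeight, Finset.sum_range_succ', h0, h.windowAttacks_zero, Finset.sum_empty,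
      add_zero, Finset.sum_sigma, Finset.sum_biUnion fun i _ j _ hij => h.disjoint hij,
      ENNReal.ofReal_sum_of_nonneg fun i _ => Finset.sum_nonneg fun k _ =>
        Finset.sum_nonneg fun j _ => hw k j]
    refine Finset.sum_congr rfl fun i _ => ?_
    rw [h0, ENNReal.ofReal_sum_of_nonneg fun k _ => Finset.sum_nonneg fun j _ => hw k j]

/-- A monotone process has not left `[0, level]` by time `l` exactly when it is at most `level`
at time `l`. -/
theorem coe_lt_exitIndex_iff {S : ℕ → Ω → ENNReal} {level : ENNReal}
    (hS : Monotone fun m => S m ω) (l : ℕ) :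
    (l : ℕ∞) < exitIndex S level ω ↔ S l ω ≤ level := by
  rw [← not_iff_not, not_lt, not_le]
  constructor
  · intro h
    have hne : ((fun m : ℕ => (m : ℕ∞)) '' {m | level < S m ω}).Nonempty := by
      rw [Set.nonempty_iff_ne_empty]
      intro h0
      rw [exitIndex, h0, sInf_empty] at h
      exact absurd h (by simp)
    obtain ⟨m, hm, hme⟩ := csInf_mem hne
    rw [exitIndex, ← hme] at h
    exact lt_of_lt_of_le hm (hS (by simpa using h))
  · exact fun h => sInf_le ⟨l, h, rfl⟩

theorem observedNodes_mono (t : ℕ → Ω → ℝ) (n : ℕ → Ω → ℕ) (τ : ℕ → Ω → ℝ) (ω : Ω) :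
    Monotone fun m => observedNodes t n τ m ω := fun _ _ h =>
  Finset.sum_le_sum_of_subset (Finset.range_mono (Nat.succ_le_succ h))

theorem observedWeight_mono (t : ℕ → Ω → ℝ) (n : ℕ → Ω → ℕ) (w : ℕ → ℕ → Ω → ℝ)
    (τ : ℕ → Ω → ℝ) (ω : Ω) : Monotone fun m => observedWeight t n w τ m ω := fun _ _ h =>
  Finset.sum_le_sum_of_subset (Finset.range_mono (Nat.succ_le_succ h))

theorem measurable_observedWeight [MeasurableSpace Ω] (ht : ∀ k, Measurable (t k))
    (hτ : ∀ i, Measurable (τ i)) (hn : ∀ k, Measurable (n k)) (hw : ∀ k j, Measurable (w k j))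
    (l : ℕ) : Measurable (observedWeight t n w τ l) :=
  Finset.measurable_fun_sum _ fun i _ => measurable_weightMeasure_window ht hτ hn hw i

end

/-- The space of the attack times, batch sizes and epochs. -/
abbrev PathSpace : Type := ((ℕ → ℝ) × (ℕ → ℕ)) × (ℕ → ℝ)

/-- `windowData` on the canonical space `PathSpace`. -/
def pathData (p : PathSpace) : ℕ → ℝ × ℕ :=
  windowData (fun k (p : PathSpace) => p.1.1 k) (fun k p => p.1.2 k) (fun i p => p.2 i) p

theorem measurable_pathData : Measurable pathData := by
  refine measurable_pi_lambda _ fun i => Measurable.prodMk ?_ ?_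
  · exact (by fun_prop : Measurable fun p : PathSpace => p.2 (i + 1) - p.2 i)
  · exact measurable_nodeCount (fun k => by fun_prop) (fun i => by fun_prop) (fun k => by fun_prop) i

/-- The event that neither the node level `M` nor the weight level `V` is exceeded at the `l`-th
observation. The process being monotone, this is the event that the exit happens after it. -/
def aliveSet (t : ℕ → Ω → ℝ) (n : ℕ → Ω → ℕ) (w : ℕ → ℕ → Ω → ℝ) (τ : ℕ → Ω → ℝ) (M : ℕ) (V : ℝ)
    (l : ℕ) : Set Ω :=
  {ω | totalNodes (windowData t n τ ω) l ≤ M ∧ observedWeight t n w τ l ω ≤ ENNReal.ofReal V}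

/-- The discounted value of an exit at observation `l + 1`: the discount over the first `l + 1`
windows, provided that the node level `M₁` is exceeded by observation `l`, and `0` otherwise. -/
def exitDiscount (M₁ : ℕ) (h : ℂ) (l : ℕ) (ζ : ℕ → ℝ × ℕ) : ℂ :=
  {ζ | M₁ < totalNodes ζ l}.indicator
    (fun ζ => discount M₁ h ζ l * Complex.exp (-h * (ζ l).1)) ζ

theorem measurable_exitDiscount (M₁ : ℕ) (h : ℂ) (l : ℕ) : Measurable (exitDiscount M₁ h l) :=
  ((measurable_discount M₁ h l).mul (by fun_prop)).indicator
    (measurableSet_lt measurable_const (measurable_totalNodes l))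

namespace ExponentialObservationModel
variable [MeasurableSpace Ω] {P : Measure Ω} {lam mu a xi : ℝ}
  {t : ℕ → Ω → ℝ} {n : ℕ → Ω → ℕ} {w : ℕ → ℕ → Ω → ℝ} {τ : ℕ → Ω → ℝ}

theorem ae_weight_nonneg (H : ExponentialObservationModel P lam mu a xi t n w τ) :
    ∀ᵐ ω ∂P, ∀ k j, 0 ≤ w k j ω := by
  refine ae_all_iff.2 fun k => ae_all_iff.2 fun j => ?_
  filter_upwards [ae_pos_of_map_eq_expMeasure (H.measurable_weight k j) (H.weight_law k j)]
    with ω hω using hω.le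

theorem measurableSet_aliveSet (H : ExponentialObservationModel P lam mu a xi t n w τ)
    (M : ℕ) (V : ℝ) (l : ℕ) : MeasurableSet (aliveSet t n w τ M V l) :=
  (measurableSet_le ((measurable_totalNodes l).comp H.measurable_windowData)
    measurable_const).inter (measurableSet_le (measurable_observedWeight H.attacks.measurable
      H.measurable_observation H.measurable_nodes H.measurable_weight l) measurable_const)

theorem ae_norm_exitDiscount_le (H : ExponentialObservationModel P lam mu a xi t n w τ)
    (M₁ : ℕ) {h : ℂ} (hh : 0 ≤ h.re) :
    ∀ᵐ ω ∂P, ∀ l, ‖exitDiscount M₁ h l (windowData t n τ ω)‖ ≤ 1 := by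
  filter_upwards [H.ae_norm_discount_le M₁ hh, H.ae_norm_exp_gap_le hh] with ω h1 h2 l
  refine (norm_indicator_le_norm_self _ _).trans ?_
  rw [norm_mul]
  exact mul_le_one₀ (h1 l) (norm_nonneg _) (h2 l)

variable [IsProbabilityMeasure P]

/-- For the attack times, batch sizes and epochs of a fixed regular path `ω₀`, and random weights,
the observed weight is a sum of independent exponential variables. -/
theorem measureReal_observedWeight_le (H : ExponentialObservationModel P lam mu a xi t n w τ)
    (hxi : 0 < xi) {V : ℝ} (hV : 0 < V) (l : ℕ) {ω₀ : Ω} (h : IsRegularPath t τ ω₀) :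
    P.real {ω | observedWeight (fun k _ => t k ω₀) (fun k _ => n k ω₀) w (fun i _ => τ i ω₀) l ω
        ≤ ENNReal.ofReal V}
      = erlangCdf (totalNodes (windowData t n τ ω₀) l) (xi * V) := by
  let E : Finset (Σ _ : ℕ, ℕ) := ((Finset.range l).biUnion fun i =>
    windowAttacks t τ ω₀ h (i + 1)).sigma (fun k => Finset.range (n k ω₀))
  have hE : E.card = totalNodes (windowData t n τ ω₀) l := by
    obtain ⟨_, h1, rfl, -⟩ := h.observedWeight_eq (n := n) (w := fun _ _ _ => 0) (by simp) l
    exact h1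
  have hind : iIndepFun (fun (p : Σ _ : ℕ, ℕ) => w p.1 p.2) P :=
    H.weight_indep.precomp (g := fun p : Σ _ : ℕ, ℕ => (p.1, p.2)) (by
      rintro ⟨a, b⟩ ⟨c, d⟩ h
      simpa using h)
  have h1 := measureReal_sum_exp_le hxi (fun p : Σ _ : ℕ, ℕ => H.measurable_weight p.1 p.2)
    (fun p => H.weight_law p.1 p.2) hind E V
  rw [if_pos hV.le, hE] at h1
  rw [← h1]
  refine measureReal_congr ?_
  filter_upwards [H.ae_weight_nonneg] with ω hω
  have hc : IsRegularPath (fun k (_ : Ω) => t k ω₀) (fun i _ => τ i ω₀) ω :=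
    ⟨h.zero, h.lt, h.finite, h.ne_zero⟩
  obtain ⟨_, -, rfl, h2⟩ := hc.observedWeight_eq (n := fun k _ => n k ω₀) (w := w) hω l
  refine propext ?_
  change observedWeight (fun k _ => t k ω₀) (fun k _ => n k ω₀) w (fun i _ => τ i ω₀) l ω
    ≤ ENNReal.ofReal V ↔ ∑ p ∈ E, w p.1 p.2 ω ≤ V
  rw [h2, ENNReal.ofReal_le_ofReal_iff hV.le]
  rfl

/-- Conditioning on all data but the weights: the constraint that the weight is at most `V`
contributes the Erlang distribution function of the number of lost nodes. -/
theorem setIntegral_observedWeight (H : ExponentialObservationModel P lam mu a xi t n w τ)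
    (hxi : 0 < xi) {V : ℝ} (hV : 0 < V) (l : ℕ) {G : (ℕ → ℝ × ℕ) → ℂ} (hG : Measurable G)
    (hGi : Integrable (fun ω => G (windowData t n τ ω)) P) :
    ∫ ω in {ω | observedWeight t n w τ l ω ≤ ENNReal.ofReal V}, G (windowData t n τ ω) ∂P
      = ∫ ω, G (windowData t n τ ω)
          * (erlangCdf (totalNodes (windowData t n τ ω) l) (xi * V) : ℂ) ∂P := by
  let C : Set ((ℕ → ℕ → ℝ) × PathSpace) := {p | observedWeight
    (fun k (p : (ℕ → ℕ → ℝ) × PathSpace) => p.2.1.1 k) (fun k p => p.2.1.2 k)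
    (fun k j p => p.1 k j) (fun i p => p.2.2 i) l p ≤ ENNReal.ofReal V}
  have hC : MeasurableSet C := measurableSet_le
    (measurable_observedWeight (fun k => by fun_prop) (fun i => by fun_prop)
      (fun k => by fun_prop) (fun k j => by fun_prop) l) measurable_const
  exact setIntegral_of_indepFun H.measurable_weights
    ((H.measurable_times.prodMk H.measurable_batches).prodMk H.measurable_epochs)
    H.indepFun_weights hC (g := fun p => G (pathData p)) (hG.comp measurable_pathData) hGi
    (q := fun p => erlangCdf (totalNodes (pathData p) l) (xi * V)) (by
      filter_upwards [H.ae_isRegularPath] with ω hω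
      exact H.measureReal_observedWeight_le hxi hV l hω)

theorem setIntegral_exitDiscount_alive (H : ExponentialObservationModel P lam mu a xi t n w τ)
    (hxi : 0 < xi) {V : ℝ} (hV : 0 < V) (M₁ M : ℕ) {h : ℂ} (hh : 0 ≤ h.re) (l l' : ℕ) :
    ∫ ω in aliveSet t n w τ M V l', exitDiscount M₁ h l (windowData t n τ ω) ∂P
      = ∫ ω in {ω | totalNodes (windowData t n τ ω) l' ≤ M},
        exitDiscount M₁ h l (windowData t n τ ω)
          * (erlangCdf (totalNodes (windowData t n τ ω) l') (xi * V) : ℂ) ∂P := by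
  have hS : MeasurableSet {ζ : ℕ → ℝ × ℕ | totalNodes ζ l' ≤ M} :=
    measurableSet_le (measurable_totalNodes l') measurable_const
  have hS' : MeasurableSet {ω | totalNodes (windowData t n τ ω) l' ≤ M} :=
    H.measurable_windowData hS
  have hm := measurable_exitDiscount M₁ h l
  have hi : Integrable (fun ω => exitDiscount M₁ h l (windowData t n τ ω)) P :=
    integrable_of_norm_le _ (hm.comp H.measurable_windowData)
      ((H.ae_norm_exitDiscount_le M₁ hh).mono fun ω hω => hω l)
  have h1 := H.setIntegral_observedWeight hxi hV l'
    (G := {ζ : ℕ → ℝ × ℕ | totalNodes ζ l' ≤ M}.indicator (exitDiscount M₁ h l))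
    (hm.indicator hS) (hi.indicator hS')
  rw [← integral_indicator hS']
  have e1 : ∀ ω, {ζ : ℕ → ℝ × ℕ | totalNodes ζ l' ≤ M}.indicator (exitDiscount M₁ h l)
      (windowData t n τ ω) = {ω | totalNodes (windowData t n τ ω) l' ≤ M}.indicator
        (fun ω => exitDiscount M₁ h l (windowData t n τ ω)) ω := fun ω => rfl
  have e2 : aliveSet t n w τ M V l' = {ω | observedWeight t n w τ l' ω ≤ ENNReal.ofReal V}
      ∩ {ω | totalNodes (windowData t n τ ω) l' ≤ M} := Set.inter_comm _ _
  rw [e2, ← setIntegral_indicator hS']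
  refine h1.trans (integral_congr_ae (Filter.Eventually.of_forall fun ω => ?_))
  by_cases hω : totalNodes (windowData t n τ ω) l' ≤ M <;> simp [hω]

theorem integrable_discount_mul_exp (H : ExponentialObservationModel P lam mu a xi t n w τ)
    (M₁ : ℕ) {h : ℂ} (hh : 0 ≤ h.re) (l : ℕ) :
    Integrable (fun ω => discount M₁ h (windowData t n τ ω) l * Complex.exp (-h * gap τ l ω)) P := by
  refine integrable_of_norm_le _ (((measurable_discount M₁ h l).comp
    H.measurable_windowData).mul (Complex.measurable_exp.comp (Measurable.mul measurable_const
      (Complex.measurable_ofReal.comp (H.measurable_gap l))))) ?_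
  filter_upwards [H.ae_norm_discount_le M₁ hh, H.ae_norm_exp_gap_le hh] with ω h1 h2
  rw [norm_mul]
  exact mul_le_one₀ (h1 l) (norm_nonneg _) (h2 l)

/-- The `l`-th window enters through its gap only, with transform `mu / (mu + h)`. -/
theorem setIntegral_exitDiscount_alive_self
    (H : ExponentialObservationModel P lam mu a xi t n w τ) (hlam : 0 < lam) (hmu : 0 < mu)
    (ha : 0 < a) (ha' : a ≤ 1) (hxi : 0 < xi) {V : ℝ} (hV : 0 < V) (M₁ K : ℕ) {h : ℂ}
    (hh : 0 ≤ h.re) (l : ℕ) :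
    ∫ ω in aliveSet t n w τ (M₁ + 1 + K) V l, exitDiscount M₁ h l (windowData t n τ ω) ∂P
      = ∑ j ∈ Finset.range (K + 1), expectedDiscount P t n τ M₁ h l (M₁ + 1 + j)
          * (mu / (mu + h)) * (erlangCdf (M₁ + 1 + j) (xi * V) : ℂ) := by
  rw [H.setIntegral_exitDiscount_alive hxi hV M₁ _ hh]
  have hm : ∀ m, MeasurableSet {ω | totalNodes (windowData t n τ ω) l = m} :=
    H.measurableSet_totalNodes l
  have hS : MeasurableSet {ω | totalNodes (windowData t n τ ω) l ≤ M₁ + 1 + K} :=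
    measurableSet_le ((measurable_totalNodes l).comp H.measurable_windowData) measurable_const
  have hi := H.integrable_discount_mul_exp M₁ hh l
  have e1 : ∀ ω, {ω | totalNodes (windowData t n τ ω) l ≤ M₁ + 1 + K}.indicator
      (fun ω => exitDiscount M₁ h l (windowData t n τ ω)
        * (erlangCdf (totalNodes (windowData t n τ ω) l) (xi * V) : ℂ)) ω
      = ∑ j ∈ Finset.range (K + 1), {ω | totalNodes (windowData t n τ ω) l = M₁ + 1 + j}.indicator
        (fun ω => discount M₁ h (windowData t n τ ω) l * Complex.exp (-h * gap τ l ω)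
          * (erlangCdf (M₁ + 1 + j) (xi * V) : ℂ)) ω := by
    intro ω
    simp only [Set.indicator_apply, Set.mem_ofPred_eq, exitDiscount]
    set N := totalNodes (windowData t n τ ω) l with hN
    by_cases hω : M₁ < N ∧ N ≤ M₁ + 1 + K
    · have hN' : M₁ + 1 + (N - (M₁ + 1)) = N := by omega
      rw [Finset.sum_eq_single (N - (M₁ + 1))]
      · rw [if_pos hω.2, if_pos hω.1, if_pos hN'.symm, hN']
        rfl
      · intro j _ hj
        exact if_neg (by omega)
      · intro h
        exact absurd (Finset.mem_range.2 (by omega)) h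
    · rw [Finset.sum_eq_zero]
      · by_cases h1 : N ≤ M₁ + 1 + K
        · rw [if_pos h1, if_neg fun h2 => hω ⟨h2, h1⟩, zero_mul]
        · exact if_neg h1
      · intro j hj
        rw [Finset.mem_range] at hj
        exact if_neg (by omega)
  rw [← integral_indicator hS, integral_congr_ae (Filter.Eventually.of_forall e1),
    integral_finsetSum _ fun j _ => (hi.mul_const _).indicator (hm _)]
  refine Finset.sum_congr rfl fun j _ => ?_
  rw [integral_indicator (hm _), integral_mul_const,
    H.setIntegral_discount_mul_exp hlam hmu ha ha' M₁ h hh]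

/-- The `l`-th window enters through its gap and its node count, with transform `windowCoeff`. -/
theorem setIntegral_exitDiscount_alive_succ
    (H : ExponentialObservationModel P lam mu a xi t n w τ) (hlam : 0 < lam) (hmu : 0 < mu)
    (ha : 0 < a) (ha' : a ≤ 1) (hxi : 0 < xi) {V : ℝ} (hV : 0 < V) (M₁ K : ℕ) {h : ℂ}
    (hh : 0 ≤ h.re) (l : ℕ) :
    ∫ ω in aliveSet t n w τ (M₁ + 1 + K) V (l + 1), exitDiscount M₁ h l (windowData t n τ ω) ∂P
      = ∑ j ∈ Finset.range (K + 1), (∑ i ∈ Finset.range (j + 1),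
          expectedDiscount P t n τ M₁ h l (M₁ + 1 + i) * windowCoeff lam mu a h (j - i))
            * (erlangCdf (M₁ + 1 + j) (xi * V) : ℂ) := by
  rw [H.setIntegral_exitDiscount_alive hxi hV M₁ _ hh]
  have hm : ∀ m x, MeasurableSet
      {ω | totalNodes (windowData t n τ ω) l = m ∧ nodeCount t n τ l ω = x} := fun m x =>
    (H.measurableSet_totalNodes l m).inter (measurable_nodeCount H.attacks.measurable
      H.measurable_observation H.measurable_nodes l (measurableSet_singleton _))
  have hS : MeasurableSet {ω | totalNodes (windowData t n τ ω) (l + 1) ≤ M₁ + 1 + K} :=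
    measurableSet_le ((measurable_totalNodes (l + 1)).comp H.measurable_windowData)
      measurable_const
  have hi := H.integrable_discount_mul_exp M₁ hh l
  have e1 : ∀ ω, {ω | totalNodes (windowData t n τ ω) (l + 1) ≤ M₁ + 1 + K}.indicator
      (fun ω => exitDiscount M₁ h l (windowData t n τ ω)
        * (erlangCdf (totalNodes (windowData t n τ ω) (l + 1)) (xi * V) : ℂ)) ω
      = ∑ j ∈ Finset.range (K + 1), ∑ i ∈ Finset.range (j + 1),
        {ω | totalNodes (windowData t n τ ω) l = M₁ + 1 + i
            ∧ nodeCount t n τ l ω = j - i}.indicator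
        (fun ω => discount M₁ h (windowData t n τ ω) l * Complex.exp (-h * gap τ l ω)
          * (erlangCdf (M₁ + 1 + j) (xi * V) : ℂ)) ω := by
    intro ω
    have hsucc : totalNodes (windowData t n τ ω) (l + 1)
        = totalNodes (windowData t n τ ω) l + nodeCount t n τ l ω := Finset.sum_range_succ _ _
    simp only [Set.indicator_apply, Set.mem_ofPred_eq, exitDiscount, hsucc]
    set N := totalNodes (windowData t n τ ω) l with hN
    set X := nodeCount t n τ l ω with hX
    by_cases hω : M₁ < N ∧ N + X ≤ M₁ + 1 + K
    · have hN' : M₁ + 1 + (N + X - (M₁ + 1)) = N + X := by omega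
      rw [Finset.sum_eq_single (N + X - (M₁ + 1)), Finset.sum_eq_single (N - (M₁ + 1))]
      · rw [if_pos hω.2, if_pos hω.1, if_pos (by omega), hN']
        rfl
      · intro i _ hi
        exact if_neg (by omega)
      · intro h
        exact absurd (Finset.mem_range.2 (by omega)) h
      · intro j _ hj
        refine Finset.sum_eq_zero fun i hi => ?_
        rw [Finset.mem_range] at hi
        exact if_neg (by omega)
      · intro h
        exact absurd (Finset.mem_range.2 (by omega)) h
    · rw [Finset.sum_eq_zero]
      · by_cases h1 : N + X ≤ M₁ + 1 + K
        · rw [if_pos h1, if_neg fun h2 => hω ⟨h2, h1⟩, zero_mul]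
        · exact if_neg h1
      · intro j hj
        refine Finset.sum_eq_zero fun i hi => ?_
        rw [Finset.mem_range] at hj hi
        exact if_neg (by omega)
  rw [← integral_indicator hS, integral_congr_ae (Filter.Eventually.of_forall e1),
    integral_finsetSum _ fun j _ => integrable_finsetSum _ fun i _ =>
      (hi.mul_const _).indicator (hm _ _)]
  refine Finset.sum_congr rfl fun j _ => ?_
  rw [integral_finsetSum _ fun i _ => (hi.mul_const _).indicator (hm _ _), Finset.sum_mul]
  refine Finset.sum_congr rfl fun i _ => ?_
  rw [integral_indicator (hm _ _), integral_mul_const,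
    H.setIntegral_discount_mul_exp_nodeCount hlam hmu ha ha' M₁ h hh]

end ExponentialObservationModel

/-! ### Pathwise decomposition at the exit and termwise integration -/

/-- If the level `M₁` is first exceeded at observation `i`, the discount factor is that of the time
elapsed since `τ_i`. -/
theorem discount_eq_exp {t : ℕ → Ω → ℝ} {n : ℕ → Ω → ℕ} {τ : ℕ → Ω → ℝ} {ω : Ω} {M₁ i : ℕ}
    (hi : ∀ l, l < i ↔ totalNodes (windowData t n τ ω) l ≤ M₁) (h : ℂ) {l : ℕ} (hl : i ≤ l) :
    discount M₁ h (windowData t n τ ω) l = Complex.exp (-h * ((τ l ω - τ i ω : ℝ) : ℂ)) := by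
  induction l, hl using Nat.le_induction with
  | base =>
    rw [sub_self, Complex.ofReal_zero, mul_zero, Complex.exp_zero]
    refine Finset.prod_eq_one fun j hj => ?_
    rw [if_neg (not_lt.2 ((hi j).1 (Finset.mem_range.1 hj)))]
    simp
  | succ l hl ih =>
    have h1 : M₁ < totalNodes (windowData t n τ ω) l :=
      not_le.1 fun h => absurd ((hi l).2 h) (not_lt.2 hl)
    have h2 : discount M₁ h (windowData t n τ ω) (l + 1)
        = discount M₁ h (windowData t n τ ω) l * Complex.exp (-h * gap τ l ω) := by
      rw [discount, Finset.prod_range_succ, if_pos h1]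
      rfl
    rw [h2, ih, ← Complex.exp_add, ← mul_add, ← Complex.ofReal_add, gap,
      add_comm, sub_add_sub_cancel]

/-- The random variable `exp (-h (τ_ρ - τ_{μ₁})) 1{μ₁ < ρ}`, where `μ₁` is the index at which the
number of lost nodes exceeds `M₁`, and `ρ` is the index at which it exceeds `M` or the lost weight
exceeds `V`. -/
def exitVariable (t : ℕ → Ω → ℝ) (n : ℕ → Ω → ℕ) (w : ℕ → ℕ → Ω → ℝ) (τ : ℕ → Ω → ℝ)
    (M₁ M : ℕ) (V : ℝ) (h : ℂ) : Ω → ℂ :=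
  Set.indicator {ω | exitIndex (observedNodes t n τ) M₁ ω
      < min (exitIndex (observedNodes t n τ) M ω)
        (exitIndex (observedWeight t n w τ) (ENNReal.ofReal V) ω)} fun ω =>
    Complex.exp (-h * ((τ (min (exitIndex (observedNodes t n τ) M ω)
        (exitIndex (observedWeight t n w τ) (ENNReal.ofReal V) ω)).toNat ω
      - τ (exitIndex (observedNodes t n τ) M₁ ω).toNat ω : ℝ) : ℂ))

/-- The contribution to `exitVariable` of the event `ρ = l + 1`. -/
def exitTerm (t : ℕ → Ω → ℝ) (n : ℕ → Ω → ℕ) (w : ℕ → ℕ → Ω → ℝ) (τ : ℕ → Ω → ℝ)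
    (M₁ M : ℕ) (V : ℝ) (h : ℂ) (l : ℕ) : Ω → ℂ :=
  (aliveSet t n w τ M V l \ aliveSet t n w τ M V (l + 1)).indicator
    fun ω => exitDiscount M₁ h l (windowData t n τ ω)

theorem aliveSet_succ_subset (t : ℕ → Ω → ℝ) (n : ℕ → Ω → ℕ) (w : ℕ → ℕ → Ω → ℝ)
    (τ : ℕ → Ω → ℝ) (M : ℕ) (V : ℝ) (l : ℕ) :
    aliveSet t n w τ M V (l + 1) ⊆ aliveSet t n w τ M V l := fun ω h =>
  ⟨(totalNodes_mono _ l.le_succ).trans h.1, (observedWeight_mono t n w τ ω l.le_succ).trans h.2⟩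

/-- On a regular path on which the level `M` is eventually exceeded, `ρ` is finite, and at most the
term with `l + 1 = ρ` is nonzero. -/
theorem IsRegularPath.hasSum_exitTerm {t : ℕ → Ω → ℝ} {n : ℕ → Ω → ℕ} {w : ℕ → ℕ → Ω → ℝ}
    {τ : ℕ → Ω → ℝ} {ω : Ω} (hω : IsRegularPath t τ ω) {M₁ M : ℕ} {V : ℝ}
    (hM : ∃ l, M < totalNodes (windowData t n τ ω) l) (h : ℂ) :
    HasSum (fun l => exitTerm t n w τ M₁ M V h l ω) (exitVariable t n w τ M₁ M V h ω) := by
  classical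
  have hN : ∀ (L l : ℕ), (l : ℕ∞) < exitIndex (observedNodes t n τ) L ω
      ↔ totalNodes (windowData t n τ ω) l ≤ L := fun L l => by
    rw [coe_lt_exitIndex_iff (observedNodes_mono t n τ ω), hω.observedNodes_eq, Nat.cast_le]
  have hN₁ := hN M₁
  set μ₁ := exitIndex (observedNodes t n τ) M₁ ω
  set ρ := min (exitIndex (observedNodes t n τ) M ω)
    (exitIndex (observedWeight t n w τ) (ENNReal.ofReal V) ω) with hρ
  have hA : ∀ l : ℕ, (l : ℕ∞) < ρ ↔ ω ∈ aliveSet t n w τ M V l := fun l => by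
    rw [hρ, lt_min_iff, hN, coe_lt_exitIndex_iff (observedWeight_mono t n w τ ω)]
    rfl
  have hv : exitVariable t n w τ M₁ M V h ω
      = if μ₁ < ρ then Complex.exp (-h * ((τ ρ.toNat ω - τ μ₁.toNat ω : ℝ) : ℂ)) else 0 := by
    rw [exitVariable, Set.indicator_apply]
    rfl
  have ht : ∀ l, exitTerm t n w τ M₁ M V h l ω = if (l : ℕ∞) < ρ ∧ ¬ ((l + 1 : ℕ) : ℕ∞) < ρ then
      exitDiscount M₁ h l (windowData t n τ ω) else 0 := fun l => by
    simp only [exitTerm, Set.indicator_apply, Set.mem_sdiff, hA]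
  rw [hv]
  simp only [ht]
  obtain ⟨l₀, hl₀⟩ := hM
  have hfin : ρ ≠ ⊤ := fun h => by
    have h1 := (hA l₀).1 (h ▸ ENat.natCast_lt_top l₀)
    exact absurd h1.1 (not_le.2 hl₀)
  clear_value ρ μ₁
  lift ρ to ℕ using hfin
  -- If `ρ = 0`, no index is below `ρ`; if `ρ = s + 1`, only the term `l = s` survives.
  rcases ρ with _ | s
  · simp
  · have e : ∀ l : ℕ, ((l : ℕ∞) < ((s + 1 : ℕ) : ℕ∞) ∧ ¬ ((l + 1 : ℕ) : ℕ∞) < ((s + 1 : ℕ) : ℕ∞))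
        ↔ l = s := fun l => by
      rw [Nat.cast_lt, Nat.cast_lt]; omega
    have e2 : μ₁ < ((s + 1 : ℕ) : ℕ∞) ↔ M₁ < totalNodes (windowData t n τ ω) s := by
      rw [← not_le (a := totalNodes (windowData t n τ ω) s), ← hN₁, not_lt, Nat.cast_add,
        Nat.cast_one, ENat.lt_add_one_iff (ENat.natCast_ne_top s)]
    simp only [e, e2]
    have h3 : (if M₁ < totalNodes (windowData t n τ ω) s then Complex.exp
        (-h * ((τ ((s + 1 : ℕ) : ℕ∞).toNat ω - τ μ₁.toNat ω : ℝ) : ℂ)) else 0)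
        = exitDiscount M₁ h s (windowData t n τ ω) := by
      simp only [exitDiscount, Set.indicator_apply, Set.mem_ofPred_eq]
      by_cases hs : M₁ < totalNodes (windowData t n τ ω) s
      · have h1 := e2.2 hs
        lift μ₁ to ℕ using h1.ne_top
        have hi : ∀ l, l < μ₁ ↔ totalNodes (windowData t n τ ω) l ≤ M₁ := fun l => by
          rw [← hN₁, Nat.cast_lt]
        have hle : μ₁ ≤ s := Nat.lt_succ_iff.1 (Nat.cast_lt.1 h1)
        have h2 : discount M₁ h (windowData t n τ ω) (s + 1) = discount M₁ h (windowData t n τ ω) s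
            * Complex.exp (-h * (windowData t n τ ω s).1) := by
          rw [discount, Finset.prod_range_succ, if_pos hs]
          rfl
        rw [if_pos hs, if_pos hs, ← h2, discount_eq_exp hi h (hle.trans s.le_succ)]
        rfl
      · rw [if_neg hs, if_neg hs]
    rw [h3]
    convert hasSum_single s fun l hl => if_neg hl using 1
    exact (if_pos rfl).symm

theorem IsRegularPath.norm_exitVariable_le {t : ℕ → Ω → ℝ} {n : ℕ → Ω → ℕ} {w : ℕ → ℕ → Ω → ℝ}
    {τ : ℕ → Ω → ℝ} {ω : Ω} (hω : IsRegularPath t τ ω) {M₁ M : ℕ} {V : ℝ}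
    (hM : ∃ l, M < totalNodes (windowData t n τ ω) l) {h : ℂ} (hh : 0 ≤ h.re) :
    ‖exitVariable t n w τ M₁ M V h ω‖ ≤ 1 := by
  obtain ⟨l₀, hl₀⟩ := hM
  have hfin : exitIndex (observedNodes t n τ) M ω ≠ ⊤ := fun h => by
    have h1 := (coe_lt_exitIndex_iff (observedNodes_mono t n τ ω) l₀).1
      (h ▸ ENat.natCast_lt_top l₀)
    rw [hω.observedNodes_eq, Nat.cast_le] at h1
    exact absurd h1 (not_le.2 hl₀)
  have hmono : Monotone fun i => τ i ω := (strictMono_nat_of_lt_succ hω.lt).monotone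
  rw [exitVariable, Set.indicator_apply]
  split_ifs with h1
  · have h2 := hmono (ENat.toNat_le_toNat h1.le (ne_top_of_le_ne_top hfin (min_le_left _ _)))
    rw [Complex.norm_exp, Real.exp_le_one_iff]
    simpa using mul_nonneg hh (sub_nonneg.2 h2)
  · simp

namespace ExponentialObservationModel
variable [MeasurableSpace Ω] {P : Measure Ω} {lam mu a xi : ℝ}
  {t : ℕ → Ω → ℝ} {n : ℕ → Ω → ℕ} {w : ℕ → ℕ → Ω → ℝ} {τ : ℕ → Ω → ℝ}

theorem measurable_exitTerm (H : ExponentialObservationModel P lam mu a xi t n w τ)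
    (M₁ M : ℕ) (V : ℝ) (h : ℂ) (l : ℕ) : Measurable (exitTerm t n w τ M₁ M V h l) :=
  ((measurable_exitDiscount M₁ h l).comp H.measurable_windowData).indicator
    ((H.measurableSet_aliveSet M V l).diff (H.measurableSet_aliveSet M V (l + 1)))

/-- The bound by an indicator of summable expectation that allows termwise integration. -/
theorem ae_norm_exitTerm_le (H : ExponentialObservationModel P lam mu a xi t n w τ)
    (M₁ M : ℕ) (V : ℝ) {h : ℂ} (hh : 0 ≤ h.re) (l : ℕ) :
    ∀ᵐ ω ∂P, ‖exitTerm t n w τ M₁ M V h l ω‖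
      ≤ {ω | totalNodes (windowData t n τ ω) l ≤ M}.indicator (fun _ => (1 : ℝ)) ω := by
  filter_upwards [H.ae_norm_exitDiscount_le M₁ hh] with ω hω
  by_cases h1 : ω ∈ aliveSet t n w τ M V l
  · rw [Set.indicator_of_mem (s := {ω | totalNodes (windowData t n τ ω) l ≤ M}) h1.1]
    exact (norm_indicator_le_norm_self _ _).trans (hω l)
  · rw [exitTerm, Set.indicator_of_notMem fun h => h1 h.1, norm_zero]
    exact Set.indicator_nonneg (fun _ _ => zero_le_one) _

variable [IsProbabilityMeasure P]

theorem ae_exists_lt_totalNodes (H : ExponentialObservationModel P lam mu a xi t n w τ)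
    (hlam : 0 < lam) (hmu : 0 < mu) (ha : 0 < a) (ha' : a ≤ 1) (M : ℕ) :
    ∀ᵐ ω ∂P, ∃ l, M < totalNodes (windowData t n τ ω) l := by
  have h0 := (H.summable_measureReal_totalNodes_le hlam hmu ha ha' M).tendsto_atTop_zero
  have h1 : P.real {ω | ¬ ∃ l, M < totalNodes (windowData t n τ ω) l} ≤ 0 :=
    ge_of_tendsto' h0 fun l => measureReal_mono fun ω hω => not_lt.1 fun h => hω ⟨l, h⟩
  rw [ae_iff]
  exact (measureReal_eq_zero_iff).1 (le_antisymm h1 measureReal_nonneg)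

theorem integrable_exitTerm (H : ExponentialObservationModel P lam mu a xi t n w τ)
    (M₁ M : ℕ) (V : ℝ) {h : ℂ} (hh : 0 ≤ h.re) (l : ℕ) :
    Integrable (exitTerm t n w τ M₁ M V h l) P :=
  integrable_of_norm_le _ (H.measurable_exitTerm M₁ M V h l)
    ((H.ae_norm_exitTerm_le M₁ M V hh l).mono fun _ hω =>
      hω.trans (Set.indicator_le_self' (fun _ _ => zero_le_one) _))

theorem summable_integral_norm_exitTerm (H : ExponentialObservationModel P lam mu a xi t n w τ)
    (hlam : 0 < lam) (hmu : 0 < mu) (ha : 0 < a) (ha' : a ≤ 1) (M₁ M : ℕ) (V : ℝ) {h : ℂ}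
    (hh : 0 ≤ h.re) : Summable fun l => ∫ ω, ‖exitTerm t n w τ M₁ M V h l ω‖ ∂P := by
  refine Summable.of_nonneg_of_le (fun l => integral_nonneg fun _ => norm_nonneg _) (fun l => ?_)
    (H.summable_measureReal_totalNodes_le hlam hmu ha ha' M)
  have hS : MeasurableSet {ω | totalNodes (windowData t n τ ω) l ≤ M} :=
    measurableSet_le ((measurable_totalNodes l).comp H.measurable_windowData) measurable_const
  refine (integral_mono_ae (H.integrable_exitTerm M₁ M V hh l).norm
    ((integrable_const 1).indicator hS) (H.ae_norm_exitTerm_le M₁ M V hh l)).trans_eq ?_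
  rw [integral_indicator_const _ hS, smul_eq_mul, mul_one]

theorem ae_hasSum_exitTerm (H : ExponentialObservationModel P lam mu a xi t n w τ)
    (hlam : 0 < lam) (hmu : 0 < mu) (ha : 0 < a) (ha' : a ≤ 1) (M₁ M : ℕ) (V : ℝ) (h : ℂ) :
    ∀ᵐ ω ∂P, HasSum (fun l => exitTerm t n w τ M₁ M V h l ω)
      (exitVariable t n w τ M₁ M V h ω) := by
  filter_upwards [H.ae_isRegularPath, H.ae_exists_lt_totalNodes hlam hmu ha ha' M] with ω h1 h2
  exact h1.hasSum_exitTerm h2 h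

theorem integrable_exitVariable (H : ExponentialObservationModel P lam mu a xi t n w τ)
    (hlam : 0 < lam) (hmu : 0 < mu) (ha : 0 < a) (ha' : a ≤ 1) (M₁ M : ℕ) (V : ℝ) {h : ℂ}
    (hh : 0 ≤ h.re) : Integrable (exitVariable t n w τ M₁ M V h) P := by
  refine Integrable.of_bound (aestronglyMeasurable_of_tendsto_ae (u := Filter.atTop)
    (f := fun s : Finset ℕ => fun ω => ∑ l ∈ s, exitTerm t n w τ M₁ M V h l ω)
    (fun s => ?_) ?_) 1 ?_
  · exact (Finset.measurable_fun_sum s fun l _ =>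
      H.measurable_exitTerm M₁ M V h l).aestronglyMeasurable
  · exact H.ae_hasSum_exitTerm hlam hmu ha ha' M₁ M V h
  · filter_upwards [H.ae_isRegularPath, H.ae_exists_lt_totalNodes hlam hmu ha ha' M]
      with ω hω hM
    exact hω.norm_exitVariable_le hM hh

theorem integral_exitTerm (H : ExponentialObservationModel P lam mu a xi t n w τ)
    (hlam : 0 < lam) (hmu : 0 < mu) (ha : 0 < a) (ha' : a ≤ 1) (hxi : 0 < xi) {V : ℝ} (hV : 0 < V)
    (M₁ K : ℕ) {h : ℂ} (hh : 0 ≤ h.re) (l : ℕ) :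
    ∫ ω, exitTerm t n w τ M₁ (M₁ + 1 + K) V h l ω ∂P = ∑ j ∈ Finset.range (K + 1),
      (expectedDiscount P t n τ M₁ h l (M₁ + 1 + j) * (mu / (mu + h))
        - ∑ i ∈ Finset.range (j + 1),
          expectedDiscount P t n τ M₁ h l (M₁ + 1 + i) * windowCoeff lam mu a h (j - i))
        * (erlangCdf (M₁ + 1 + j) (xi * V) : ℂ) := by
  have hA := H.measurableSet_aliveSet (M₁ + 1 + K) V
  have hi : Integrable (fun ω => exitDiscount M₁ h l (windowData t n τ ω)) P :=
    integrable_of_norm_le _ ((measurable_exitDiscount M₁ h l).comp H.measurable_windowData)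
      ((H.ae_norm_exitDiscount_le M₁ hh).mono fun ω hω => hω l)
  rw [exitTerm, integral_indicator ((hA l).diff (hA (l + 1))),
    setIntegral_sdiff (hA (l + 1)) hi.integrableOn (aliveSet_succ_subset ..),
    H.setIntegral_exitDiscount_alive_self hlam hmu ha ha' hxi hV M₁ K hh,
    H.setIntegral_exitDiscount_alive_succ hlam hmu ha ha' hxi hV M₁ K hh,
    ← Finset.sum_sub_distrib]
  exact Finset.sum_congr rfl fun j _ => (sub_mul _ _ _).symm

theorem integral_exitVariable (H : ExponentialObservationModel P lam mu a xi t n w τ)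
    (hlam : 0 < lam) (hmu : 0 < mu) (ha : 0 < a) (ha' : a ≤ 1) (hxi : 0 < xi) {V : ℝ} (hV : 0 < V)
    (M₁ K : ℕ) {h : ℂ} (hh : 0 ≤ h.re) {u : ℕ → ℂ} (h0 : u 0 = 1)
    (hu : ∀ j, u (j + 1) = dFun lam mu a 0 * u j + (cFun lam a h - 1) * cFun lam a h ^ j) :
    ∫ ω, exitVariable t n w τ M₁ (M₁ + 1 + K) V h ω ∂P
      = a * mu ^ 2 * lam / ((mu + lam) * (mu + h) * (h + lam))
        * ∑ j ∈ Finset.range (K + 1), u j * (erlangCdf (M₁ + 1 + j) (xi * V) : ℂ) := by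
  have h1 := hasSum_integral_of_summable_integral_norm
    (H.integrable_exitTerm M₁ (M₁ + 1 + K) V hh)
    (H.summable_integral_norm_exitTerm hlam hmu ha ha' M₁ (M₁ + 1 + K) V hh)
  have h2 : ∫ ω, exitVariable t n w τ M₁ (M₁ + 1 + K) V h ω ∂P
      = ∫ ω, ∑' l, exitTerm t n w τ M₁ (M₁ + 1 + K) V h l ω ∂P := by
    refine integral_congr_ae ?_
    filter_upwards [H.ae_hasSum_exitTerm hlam hmu ha ha' M₁ (M₁ + 1 + K) V h] with ω hω
      using hω.tsum_eq.symm
  have hy : ∀ m, HasSum (fun l => expectedDiscount P t n τ M₁ h l m)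
      (∑' l, expectedDiscount P t n τ M₁ h l m) := fun m =>
    (H.summable_norm_expectedDiscount hlam hmu ha ha' M₁ hh m).of_norm.hasSum
  have h3 : HasSum (fun l => ∫ ω, exitTerm t n w τ M₁ (M₁ + 1 + K) V h l ω ∂P)
      (∑ j ∈ Finset.range (K + 1), (a * mu ^ 2 * lam / ((mu + lam) * (mu + h) * (h + lam)) * u j)
        * (erlangCdf (M₁ + 1 + j) (xi * V) : ℂ)) := by
    simp only [H.integral_exitTerm hlam hmu ha ha' hxi hV M₁ K hh]
    refine hasSum_sum fun j _ => HasSum.mul_right _ ?_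
    -- Each coefficient of the Erlang functions is a finite combination of the convergent series `y`.
    rw [← sum_renewal_eq hlam hmu hh (H.tsum_expectedDiscount_eq hlam hmu ha ha' M₁ hh) u h0 hu j,
      mul_comm (mu / (mu + h) : ℂ)]
    exact ((hy _).mul_right _).sub (hasSum_sum fun i _ => (hy _).mul_right _)
  rw [h2, h1.unique h3, Finset.mul_sum]
  exact Finset.sum_congr rfl fun j _ => mul_assoc _ _ _

end ExponentialObservationModel

/-! ### The closed formula -/

/-- The first-order recursion satisfied by the bracket of the formula. -/
theorem erlangCdf_sub_div_pow (d : ℂ) (hd : d ≠ 0) (xi V : ℝ) (lam mu a : ℝ)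
    (hda : dFun lam mu a 0 = d) (m : ℕ) :
    ((erlangCdf m (xi * V) : ℂ)
        - (Complex.exp (-xi * (1 - d) * V) - rFun lam mu a xi V m 1 0 0) / d ^ m)
      - d * ((erlangCdf (m + 1) (xi * V) : ℂ)
        - (Complex.exp (-xi * (1 - d) * V) - rFun lam mu a xi V (m + 1) 1 0 0) / d ^ (m + 1))
      = (1 - d) * (erlangCdf (m + 1) (xi * V) : ℂ) := by
  have h1 : rFun lam mu a xi V (m + 1) 1 0 0 = rFun lam mu a xi V m 1 0 0
      + d ^ m * (Complex.exp (-xi * V) * (xi * V) ^ m / m.factorial) := by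
    simp only [rFun, hda, Finset.sum_range_succ]
    rw [mul_add, zero_add, neg_mul, mul_one,
      show (xi * d * V : ℂ) = d * (xi * V) by ring, mul_pow]
    ring
  have h2 : (erlangCdf (m + 1) (xi * V) : ℂ) = erlangCdf m (xi * V)
      - Complex.exp (-xi * V) * (xi * V) ^ m / m.factorial := by
    simp only [erlangCdf, Finset.sum_range_succ]
    push_cast
    rw [neg_mul]
    ring
  rw [h1, h2, pow_succ]
  field_simp
  ring

end NetworkDefense

end

theorem proposition5p11 {Ω : Type*} [MeasurableSpace Ω] (P : Measure Ω) [IsProbabilityMeasure P]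
    (lam mu a xi : ℝ) (hlam : 0 < lam) (hmu : 0 < mu) (ha : 0 < a) (ha' : a ≤ 1) (hxi : 0 < xi)
    (t : ℕ → Ω → ℝ) (n : ℕ → Ω → ℕ) (w : ℕ → ℕ → Ω → ℝ) (τ : ℕ → Ω → ℝ)
    (hmodel : NetworkDefense.ExponentialObservationModel P lam mu a xi t n w τ)
    (M₁ M : ℕ) (hM : M₁ < M) (V : ℝ) (hV : 0 < V) (h : ℂ) (hh : 0 ≤ h.re) :
    let μ₁ : Ω → ℕ∞ := NetworkDefense.exitIndex (NetworkDefense.observedNodes t n τ) (M₁ : ENNReal)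
    let μ : Ω → ℕ∞ := NetworkDefense.exitIndex (NetworkDefense.observedNodes t n τ) (M : ENNReal)
    let ν : Ω → ℕ∞ :=
      NetworkDefense.exitIndex (NetworkDefense.observedWeight t n w τ) (ENNReal.ofReal V)
    let f : Ω → ℂ := Set.indicator {ω | μ₁ ω < min (μ ω) (ν ω)} fun ω =>
      Complex.exp (-h * ((τ (min (μ ω) (ν ω)).toNat ω - τ (μ₁ ω).toNat ω : ℝ) : ℂ))
    let c : ℂ := NetworkDefense.cFun lam a h
    let d : ℂ := NetworkDefense.dFun lam mu a 0
    let r : ℕ → ℂ := fun m => NetworkDefense.rFun lam mu a xi V m 1 0 0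
    let s : ℂ := NetworkDefense.sFun lam mu a M₁ M h 0
    let p : ℕ → ℂ := fun m => (NetworkDefense.regGamma m (xi * V) : ℂ)
    Integrable f P ∧
    ∫ ω, f ω ∂P =
      a * mu ^ 2 * lam / ((mu + lam) * (mu + h) * (h + lam) * (1 - d)) *
        ((p M₁ - (Complex.exp (-xi * (1 - d) * V) - r M₁) / d ^ M₁)
          + (c - 1) / c * ∑ j ∈ Finset.Icc 1 (M - M₁ - 1),
              c ^ j * (p (M₁ + j) - (Complex.exp (-xi * (1 - d) * V) - r (M₁ + j)) / d ^ (M₁ + j))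
          - d ^ (M - M₁) * (1 + (c - 1) / c * s)
              * (p M - (Complex.exp (-xi * (1 - d) * V) - r M) / d ^ M)) := by
  intro μ₁ μ ν f c d r s p
  refine ⟨hmodel.integrable_exitVariable hlam hmu ha ha' M₁ M V hh, ?_⟩
  obtain ⟨K, rfl⟩ : ∃ K, M = M₁ + 1 + K := ⟨M - M₁ - 1, by omega⟩
  have hd : d ≠ 0 := NetworkDefense.dFun_zero_ne_zero hlam hmu ha'
  have hd1 : 1 - d ≠ 0 := by
    rw [NetworkDefense.one_sub_dFun_zero hlam hmu]
    exact_mod_cast (by positivity : a * mu / (mu + lam) ≠ 0)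
  have hp : ∀ m, p m = (NetworkDefense.erlangCdf m (xi * V) : ℂ) := fun m =>
    congrArg Complex.ofReal (NetworkDefense.regGamma_natCast m (mul_pos hxi hV))
  -- The coefficients of `(1 - X) / ((1 - d X) (1 - c X))`, by their recursion.
  let u : ℕ → ℂ := fun j => Nat.rec 1 (fun i x => d * x + (c - 1) * c ^ i) j
  have hI := hmodel.integral_exitVariable hlam hmu ha ha' hxi hV M₁ K hh (u := u) rfl fun _ => rfl
  have hT := NetworkDefense.sum_icc_telescope (NetworkDefense.cFun_ne_zero hlam ha' hh) hd
    (Q := fun m => p m - (Complex.exp (-xi * (1 - d) * V) - r m) / d ^ m) (G := p)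
    (fun m => by
      simp only [hp]
      exact NetworkDefense.erlangCdf_sub_div_pow d hd xi V lam mu a rfl m)
    (u := u) rfl (fun _ => rfl) M₁ K
  have e1 : M₁ + 1 + K - M₁ - 1 = K := by omega
  have e2 : M₁ + 1 + K - M₁ = K + 1 := by omega
  have e3 : M₁ + K + 1 = M₁ + 1 + K := by omega
  have hs : s = ∑ i ∈ Finset.Icc 1 K, (c / d) ^ i := by rw [← e1]; rfl
  rw [e3] at hT
  rw [e1, e2, hs]
  refine hI.trans ?_
  refine Eq.trans ?_ (congrArg
    (a * mu ^ 2 * lam / ((mu + lam) * (mu + h) * (h + lam) * (1 - d)) * ·) hT.symm)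
  simp only [hp]
  rw [← mul_assoc, ← div_div _ _ (1 - d), div_mul_cancel₀ _ hd1]
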